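/- Let $\delta\in[-\infty,\infty)$, where $[-\infty,\infty)$ is read as $\mathbb R$, let $V:[\delta,\infty)\to\mathbb R$ be measurable, and assume that $\mu(dx):=1_{[\delta,\infty)}(x)e^{V(x)}dx$ is a probability measure. For $r\ge\delta$ put $$\Phi_\delta(r):=\frac1{c_\delta}\int_\delta^r e^{-s^2/2}\,ds,\qquad c_\delta:=\int_\delta^\infty e^{-s^2/2}\,ds,\qquad \varphi(r):=\mu([\delta,r))=\int_\delta^r e^{V(x)}\,dx,$$ and let $$\alpha:=\Big(\frac{\Phi_\delta'\circ\Phi_\delta^{-1}\circ\varphi}{\varphi'}\Big)^2,\qquad \rho(x,y):=\big|\Phi_\delta^{-1}\circ\varphi(x)-\Phi_\delta^{-1}\circ\varphi(y)\big|,\quad x,y\ge\delta .$$ Write $\mu(g)$ for $\int g\,d\mu$, let $C_0^\infty([\delta,\infty))$ be the space of smooth functions on $[\delta,\infty)$ (up to the endpoint, where they need not vanish) with compact support, and let $$W_2^\rho(\mu_1,\mu_2):=\Big\{\inf_{\pi\in\mathscr C(\mu_1,\mu_2)}\int\rho(x,y)^2\,\pi(dx,dy)\Big\}^{1/2},$$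 where $\mathscr C(\mu_1,\mu_2)$ is the set of probability measures on $[\delta,\infty)\times[\delta,\infty)$ with marginals $\mu_1$ and $\mu_2$. Then the following hold. (1) (Weighted log-Sobolev inequality) $\mu(f^2\log f^2)\le 2\,\mu(\alpha f'^2)$ for all $f\in C_0^\infty([\delta,\infty))$ with $\mu(f^2)=1$. (2) (Talagrand inequality) $W_2^\rho(\mu,f^2\mu)^2\le 2\,\mu(f^2\log f^2)$ for all measurable $f$ with $\mu(f^2)=1$. (3) (HWI inequality) $\mu(f^2\log f^2)+\tfrac12W_2^\rho(\mu,f^2\mu)^2\le 2\sqrt{\mu(\alpha f'^2)}\;W_2^\rho(\mu,f^2\mu)$ for all $f\in C_0^\infty([\delta,\infty))$ with $\mu(f^2)=1$. (Both sides may be $+\infty$.) -/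

import Mathlib

open MeasureTheory Set
open scoped ENNReal ContDiff

noncomputable section

/-- The half-line `[δ, ∞) ⊆ ℝ`; for `δ = ⊥` (that is, `δ = -∞`) it is the whole of `ℝ`. -/
def halfLine (δ : WithBot ℝ) : Set ℝ := {x | δ ≤ (x : WithBot ℝ)}

/-- The measure `1_{[δ, ∞)}(x) e^{V(x)} dx`. -/
def expMeasure (δ : WithBot ℝ) (V : ℝ → ℝ) : Measure ℝ :=
  (volume.restrict (halfLine δ)).withDensity fun x => ENNReal.ofReal (Real.exp (V x))

/-- The normalization `c_δ = ∫_δ^∞ e^{-s²/2} ds`. -/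
def gaussNorm (δ : WithBot ℝ) : ℝ := ∫ s in halfLine δ, Real.exp (-s ^ 2 / 2)

/-- `Φ_δ(r) = c_δ⁻¹ ∫_δ^r e^{-s²/2} ds`, the distribution function of the Gaussian measure
restricted to `[δ, ∞)`. -/
def gaussCDF (δ : WithBot ℝ) (r : ℝ) : ℝ :=
  (1 / gaussNorm δ) * ∫ s in halfLine δ ∩ Iio r, Real.exp (-s ^ 2 / 2)

/-- The inverse `Φ_δ⁻¹` of `Φ_δ : [δ, ∞) → [0, 1)`. -/
def gaussCDFInv (δ : WithBot ℝ) : ℝ → ℝ := Function.invFunOn (gaussCDF δ) (halfLine δ)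

/-- `φ(r) = μ([δ, r))` for `μ = 1_{[δ, ∞)} e^V dx`. -/
def expCDF (δ : WithBot ℝ) (V : ℝ → ℝ) (r : ℝ) : ℝ :=
  (expMeasure δ V).real (halfLine δ ∩ Iio r)

/-- The map `y = Φ_δ⁻¹ ∘ φ`. -/
def transportMap (δ : WithBot ℝ) (V : ℝ → ℝ) (x : ℝ) : ℝ := gaussCDFInv δ (expCDF δ V x)

/-- The weight `α = (Φ_δ' ∘ Φ_δ⁻¹ ∘ φ / φ')²`, derivatives being taken in `[δ, ∞)`. -/
def weight (δ : WithBot ℝ) (V : ℝ → ℝ) (x : ℝ) : ℝ :=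
  (derivWithin (gaussCDF δ) (halfLine δ) (gaussCDFInv δ (expCDF δ V x)) /
    derivWithin (expCDF δ V) (halfLine δ) x) ^ 2

/-- The distance `ρ(x₁, x₂) = |Φ_δ⁻¹(φ(x₁)) - Φ_δ⁻¹(φ(x₂))|`. -/
def transportDist (δ : WithBot ℝ) (V : ℝ → ℝ) (x₁ x₂ : ℝ) : ℝ :=
  |transportMap δ V x₁ - transportMap δ V x₂|

/-- The couplings of `μ₁` and `μ₂`: the measures on the product with these marginals. -/
def couplings {E : Type*} [MeasurableSpace E] (μ₁ μ₂ : Measure E) : Set (Measure (E × E)) :=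
  {π | π.map Prod.fst = μ₁ ∧ π.map Prod.snd = μ₂}

/-- The `L²`-Wasserstein distance `W_2^ρ(μ₁, μ₂) = (inf_π ∫ ρ(x, y)² π(dx, dy))^{1/2}`,
with values in `[0, ∞]`. -/
def wasserstein2 {E : Type*} [MeasurableSpace E] (ρ : E → E → ℝ) (μ₁ μ₂ : Measure E) : ℝ≥0∞ :=
  (⨅ π ∈ couplings μ₁ μ₂, ∫⁻ z, ENNReal.ofReal (ρ z.1 z.2 ^ 2) ∂π) ^ (1 / 2 : ℝ)

/-- The measure `f² μ`. -/
def sqDensity (μ : Measure ℝ) (f : ℝ → ℝ) : Measure ℝ :=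
  μ.withDensity fun x => ENNReal.ofReal (f x ^ 2)

/-- The integral `∫ g dμ` as the integral of the positive part minus that of the negative part,
with values in `[-∞, ∞]`. -/
def extIntegral (μ : Measure ℝ) (g : ℝ → ℝ) : EReal :=
  ((∫⁻ x, ENNReal.ofReal (g x) ∂μ : ℝ≥0∞) : EReal) -
    ((∫⁻ x, ENNReal.ofReal (-g x) ∂μ : ℝ≥0∞) : EReal)

/-- `μ(f² log f²)`; on a probability space it lies in `(-∞, ∞]`, as `t log t ≥ -1/e`. -/
def sqEntropy (μ : Measure ℝ) (f : ℝ → ℝ) : EReal :=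
  extIntegral μ fun x => f x ^ 2 * Real.log (f x ^ 2)

/-- The weighted energy `μ(α f'²)`, with values in `[0, ∞]`. -/
def weightedEnergy (δ : WithBot ℝ) (V f : ℝ → ℝ) : ℝ≥0∞ :=
  ∫⁻ x, ENNReal.ofReal (weight δ V x * derivWithin f (halfLine δ) x ^ 2) ∂(expMeasure δ V)

/-- `f ∈ C_0^∞([δ, ∞))`: smooth on `[δ, ∞)`, up to and including the endpoint (where `f` need not
vanish), and zero outside a compact set. The values of `f` outside `[δ, ∞)` play no role. -/
def IsTestFunction (δ : WithBot ℝ) (f : ℝ → ℝ) : Prop :=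
  ContDiffOn ℝ ∞ f (halfLine δ) ∧ ∃ K : Set ℝ, IsCompact K ∧ ∀ x ∈ halfLine δ, x ∉ K → f x = 0

end

section

open Filter Topology
open ProbabilityTheory (cdf cdf_nonneg cdf_le_one tendsto_cdf_atTop tendsto_cdf_atBot cdf_eq_real
  ofReal_cdf measure_cdf)

/-! Let γ be the normalized Gaussian measure on [δ,∞), with density w. The monotone map T =
`transportMap δ V` carries μ to γ, and ρ is the Euclidean distance pulled back by T. For a
probability measure ν = hμ let S = `gaussMap δ ν` be the monotone map from ν to γ. The monotone
coupling of μ and ν is optimal, so W² = ∫ (S−T)² h dμ (`wasserstein2_sq_eq`). The Monge-Ampère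
equations S' w(S) = h e^V and T' w(T) = e^V (`ae_deriv_gaussMap`) give log h = (T²−S²)/2 +
log(S'/T'), and almost everywhere α = (w(T)/e^V)².

Talagrand: use log r ≥ 1 − 1/r at r = S'/T' and integrate by parts against w(S); the quadratic terms
add up to (S−T)²/2 (`integral_transport_le`). HWI: use log r ≤ r − 1 and integrate by parts against
h w(T); the quadratic terms add up to −(S−T)²/2, and what remains is −∫ h' w(T)(S−T), which for h =
f² is at most 2 √μ(αf'²) W (`integral_entropy_le`, with Cauchy-Schwarz in Young form). The
log-Sobolev inequality follows from HWI, since 2√E W ≤ 2E + W²/2.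

The remaining work is the boundary terms. For Talagrand, h is replaced by a multiple of itself on a
compact interval and by 1 outside, so that S = T at the ends. For HWI, f² is replaced by (1−ε)f² +
ε; a Gaussian tail estimate then bounds S−T from the side that matters, while w(T) tends to 0. The
limits are taken in `crossingCost`, which expresses W² through distribution functions alone:
`crossingCost_le_liminf` gives lower semicontinuity, and `crossingCost_le_of_between` shows that
mixing with μ does not increase the cost. -/

/-! ### The half-line. -/

theorem halfLine_bot : halfLine ⊥ = univ := by
  ext x; simp [halfLine]

theorem halfLine_coe (d : ℝ) : halfLine (d : WithBot ℝ) = Ici d := by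
  ext x; simp [halfLine]

theorem isClosed_halfLine (δ : WithBot ℝ) : IsClosed (halfLine δ) := by
  induction δ with
  | bot => rw [halfLine_bot]; exact isClosed_univ
  | coe d => rw [halfLine_coe]; exact isClosed_Ici

theorem measurableSet_halfLine (δ : WithBot ℝ) : MeasurableSet (halfLine δ) :=
  (isClosed_halfLine δ).measurableSet

theorem halfLine_mono {δ : WithBot ℝ} {x y : ℝ} (hx : x ∈ halfLine δ) (hxy : x ≤ y) :
    y ∈ halfLine δ :=
  le_trans (show δ ≤ (x : WithBot ℝ) from hx) (WithBot.coe_le_coe.2 hxy)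

theorem Icc_subset_halfLine {δ : WithBot ℝ} {a : ℝ} (ha : a ∈ halfLine δ) (b : ℝ) :
    Icc a b ⊆ halfLine δ := fun _ hx => halfLine_mono ha hx.1

theorem uniqueDiffOn_halfLine (δ : WithBot ℝ) : UniqueDiffOn ℝ (halfLine δ) := by
  induction δ with
  | bot => rw [halfLine_bot]; exact uniqueDiffOn_univ
  | coe d => rw [halfLine_coe]; exact uniqueDiffOn_Ici d

theorem halfLine_mem_nhds {δ : WithBot ℝ} {a x : ℝ} (ha : a ∈ halfLine δ) (hx : a < x) :
    halfLine δ ∈ 𝓝 x :=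
  mem_of_superset (Ici_mem_nhds hx) fun _ hy => halfLine_mono ha hy

/-- The common range of the distribution functions on `[δ, ∞)` of the measures equivalent to
Lebesgue measure there. -/
def cdfRange (δ : WithBot ℝ) : Set ℝ := {u | 0 ≤ u ∧ u < 1 ∧ (δ = ⊥ → 0 < u)}

theorem ae_mem_halfLine {δ : WithBot ℝ} {ν : Measure ℝ}
    (h : ν ≪ volume.restrict (halfLine δ)) : ∀ᵐ x ∂ν, x ∈ halfLine δ :=
  h.ae_le (ae_restrict_mem (measurableSet_halfLine δ))

theorem measure_pos_of_Ioo_subset {δ : WithBot ℝ} {m : Measure ℝ}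
    (h : volume.restrict (halfLine δ) ≪ m) {s : Set ℝ} {a b : ℝ}
    (ha : a ∈ halfLine δ) (hab : a < b) (hs : Ioo a b ⊆ s) : 0 < m s := by
  refine pos_iff_ne_zero.2 fun h0 => ?_
  have h1 := h (measure_mono_null hs h0)
  rw [Measure.restrict_apply measurableSet_Ioo, inter_eq_left.2
    (Ioo_subset_Icc_self.trans (Icc_subset_halfLine ha b)), Real.volume_Ioo,
    ENNReal.ofReal_eq_zero] at h1
  linarith

/-! ### Distribution functions, quantiles and the monotone rearrangement. -/

section Quantile

variable {δ : WithBot ℝ} {m ν : Measure ℝ} [IsProbabilityMeasure m] [IsProbabilityMeasure ν]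

theorem continuous_cdf (h : ν ≪ volume.restrict (halfLine δ)) : Continuous (cdf ν) := by
  refine continuous_iff_continuousAt.2 fun x => ?_
  have h0 : (cdf ν).measure {x} = 0 := by rw [measure_cdf]; exact h (by simp)
  rw [StieltjesFunction.measure_singleton, ENNReal.ofReal_eq_zero] at h0
  have hl : Function.leftLim (cdf ν) x = cdf ν x :=
    le_antisymm ((cdf ν).mono.leftLim_le le_rfl) (by linarith)
  refine continuousAt_iff_continuous_left'_right'.2 ⟨?_, ?_⟩
  · have := (cdf ν).mono.tendsto_leftLim x
    rwa [hl] at this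
  · exact ((cdf ν).right_continuous x).mono Ioi_subset_Ici_self

theorem cdf_eq_zero_of_notMem (h : ν ≪ volume.restrict (halfLine δ)) {x : ℝ}
    (hx : ∀ y < x, y ∉ halfLine δ) : cdf ν x = 0 := by
  have h0 : ν (Iic x) = 0 := by
    refine h ?_
    rw [Measure.restrict_apply measurableSet_Iic]
    refine measure_mono_null (t := {x}) ?_ (by simp)
    rintro y ⟨hy, hyJ⟩
    by_contra hne
    exact hx y (lt_of_le_of_ne hy hne) hyJ
  rw [cdf_eq_real, measureReal_def, h0, ENNReal.toReal_zero]

theorem cdf_real_sub (x y : ℝ) (hxy : x ≤ y) : cdf ν y - cdf ν x = ν.real (Ioc x y) := by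
  have h := measureReal_sdiff (μ := ν) (Iic_subset_Iic.2 hxy) measurableSet_Iic
  rw [cdf_eq_real, cdf_eq_real, ← h]
  congr 1
  ext z
  simp [and_comm]

theorem strictMonoOn_cdf (h : volume.restrict (halfLine δ) ≪ m) :
    StrictMonoOn (cdf m) (halfLine δ) := by
  intro x hx y hy hxy
  have h1 := measure_pos_of_Ioo_subset h hx hxy Ioo_subset_Ioc_self
  have h2 := cdf_real_sub (ν := m) x y hxy.le
  have h3 : 0 < m.real (Ioc x y) := ENNReal.toReal_pos h1.ne' (measure_ne_top _ _)
  linarith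

theorem cdf_lt_one (h : volume.restrict (halfLine δ) ≪ m) (x : ℝ) : cdf m x < 1 := by
  obtain ⟨y, hxy, hy⟩ : ∃ y, x ≤ y ∧ y ∈ halfLine δ := by
    induction δ with
    | bot => exact ⟨x, le_rfl, by simp [halfLine_bot]⟩
    | coe d => exact ⟨max x d, le_max_left _ _, by simp [halfLine_coe]⟩
  exact ((cdf m).mono hxy).trans_lt ((strictMonoOn_cdf h hy (halfLine_mono hy (by simp))
    (lt_add_one y)).trans_le (cdf_le_one m _))

theorem cdf_mem_cdfRange (h : volume.restrict (halfLine δ) ≪ m) (x : ℝ) :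
    cdf m x ∈ cdfRange δ := by
  refine ⟨cdf_nonneg m x, cdf_lt_one h x, ?_⟩
  rintro rfl
  have h1 : ∀ y, y ∈ halfLine ⊥ := by simp [halfLine_bot]
  exact (cdf_nonneg m (x - 1)).trans_lt (strictMonoOn_cdf h (h1 _) (h1 _) (sub_one_lt x))

theorem exists_cdf_eq (h : ν ≪ volume.restrict (halfLine δ)) {u : ℝ} (hu : u ∈ cdfRange δ) :
    ∃ x ∈ halfLine δ, cdf ν x = u := by
  obtain ⟨h0, h1, h2⟩ := hu
  have hc := continuous_cdf h
  obtain ⟨y, hy⟩ : ∃ y, u < cdf ν y := ((tendsto_cdf_atTop ν).eventually_const_lt h1).exists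
  obtain ⟨a, ha, hau⟩ : ∃ a ∈ halfLine δ, cdf ν a ≤ u := by
    induction δ with
    | bot =>
      obtain ⟨a, ha⟩ := ((tendsto_cdf_atBot ν).eventually_lt_const (h2 rfl)).exists
      exact ⟨a, by simp [halfLine_bot], ha.le⟩
    | coe d =>
      refine ⟨d, by simp [halfLine_coe], ?_⟩
      rw [cdf_eq_zero_of_notMem h fun y hy => by simp [halfLine_coe, hy]]
      exact h0
  have hay : a ≤ y := le_of_not_gt fun hlt =>
    absurd (((cdf ν).mono hlt.le).trans hau) (not_le.2 hy)
  obtain ⟨x, hx, hxu⟩ := intermediate_value_Icc hay hc.continuousOn ⟨hau, hy.le⟩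
  exact ⟨x, halfLine_mono ha hx.1, hxu⟩

/-- The inverse on `[δ, ∞)` of the distribution function of `m`. -/
noncomputable def quantile (δ : WithBot ℝ) (m : Measure ℝ) : ℝ → ℝ :=
  Function.invFunOn (cdf m) (halfLine δ)

theorem quantile_mem (h : m ≪ volume.restrict (halfLine δ)) {u : ℝ} (hu : u ∈ cdfRange δ) :
    quantile δ m u ∈ halfLine δ :=
  Function.invFunOn_mem (exists_cdf_eq h hu)

theorem cdf_quantile (h : m ≪ volume.restrict (halfLine δ)) {u : ℝ} (hu : u ∈ cdfRange δ) :
    cdf m (quantile δ m u) = u :=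
  Function.invFunOn_eq (exists_cdf_eq h hu)

theorem quantile_cdf (h : volume.restrict (halfLine δ) ≪ m) {x : ℝ} (hx : x ∈ halfLine δ) :
    quantile δ m (cdf m x) = x :=
  (strictMonoOn_cdf h).injOn.leftInvOn_invFunOn hx

theorem quantile_le_iff (h : m ≪ volume.restrict (halfLine δ))
    (h' : volume.restrict (halfLine δ) ≪ m) {u x : ℝ} (hu : u ∈ cdfRange δ)
    (hx : x ∈ halfLine δ) : quantile δ m u ≤ x ↔ u ≤ cdf m x := by
  conv_rhs => rw [← cdf_quantile h hu]
  exact ((strictMonoOn_cdf h').le_iff_le (quantile_mem h hu) hx).symm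

theorem strictMonoOn_quantile (h : m ≪ volume.restrict (halfLine δ))
    (h' : volume.restrict (halfLine δ) ≪ m) : StrictMonoOn (quantile δ m) (cdfRange δ) := by
  intro u hu v hv huv
  rw [← not_le, quantile_le_iff h h' hv (quantile_mem h hu), cdf_quantile h hu]
  exact not_le.2 huv

/-- Probability integral transform. The distribution function of ν may have flat pieces; continuity
alone makes a nonempty sublevel set a closed ray at whose end the value is exactly u. -/
theorem measure_cdf_le (h : ν ≪ volume.restrict (halfLine δ)) {u : ℝ} (hu1 : u < 1) :
    ν {x | cdf ν x ≤ u} = ENNReal.ofReal u := by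
  have hc := continuous_cdf h
  rcases (Set.eq_empty_or_nonempty {x | cdf ν x ≤ u}) with he | hne
  · have : u ≤ 0 := by
      refine le_of_not_gt fun hlt => ?_
      obtain ⟨a, ha⟩ := ((tendsto_cdf_atBot ν).eventually_lt_const hlt).exists
      exact (he ▸ (show a ∈ {x | cdf ν x ≤ u} from ha.le) : a ∈ (∅ : Set ℝ))
    rw [he, measure_empty, ENNReal.ofReal_of_nonpos this]
  · obtain ⟨y, hy⟩ : ∃ y, u < cdf ν y := ((tendsto_cdf_atTop ν).eventually_const_lt hu1).exists
    have hbdd : BddAbove {x | cdf ν x ≤ u} := ⟨y, fun x hx => le_of_not_gt fun hlt =>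
      absurd (((cdf ν).mono hlt.le).trans hx) (not_le.2 hy)⟩
    have hcl : IsClosed {x | cdf ν x ≤ u} := isClosed_le hc continuous_const
    set z := sSup {x | cdf ν x ≤ u} with hz
    have hzm : cdf ν z ≤ u := hcl.csSup_mem hne hbdd
    have hset : {x | cdf ν x ≤ u} = Iic z := by
      ext x
      exact ⟨fun hx => le_csSup hbdd hx, fun hx => ((cdf ν).mono hx).trans hzm⟩
    have hzu : cdf ν z = u := by
      refine le_antisymm hzm (ge_of_tendsto (hc.continuousWithinAt (s := Ioi z) (x := z)) ?_)
      filter_upwards [self_mem_nhdsWithin] with x hx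
      exact le_of_not_ge fun hle => absurd (le_csSup hbdd hle) (not_le.2 hx)
    rw [hset, ← ofReal_cdf, hzu]

/-- Since ν may vanish on parts of the half-line, its distribution function may take the excluded
extreme values, where `quantile` is an arbitrary choice. By the probability integral transform this
happens only on a ν-null set. -/
theorem ae_cdf_mem_cdfRange (h : ν ≪ volume.restrict (halfLine δ)) :
    ∀ᵐ x ∂ν, cdf ν x ∈ cdfRange δ := by
  have hc := continuous_cdf h
  have h0 : ∀ᵐ x ∂ν, 0 < cdf ν x := by
    rw [ae_iff]
    simpa using measure_cdf_le h one_pos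
  have h1 : ∀ᵐ x ∂ν, cdf ν x < 1 := by
    rw [ae_iff]
    have hle : ∀ u : ℝ, 0 ≤ u → u < 1 → ν {x | ¬ cdf ν x < 1} ≤ ENNReal.ofReal (1 - u) := by
      intro u hu hu1
      have hm : MeasurableSet {x | cdf ν x ≤ u} := (isClosed_le hc continuous_const).measurableSet
      calc ν {x | ¬ cdf ν x < 1} ≤ ν {x | cdf ν x ≤ u}ᶜ := by
            refine measure_mono fun x hx => ?_
            simp only [mem_ofPred_eq, mem_compl_iff, not_lt, not_le] at hx ⊢
            linarith
        _ = ENNReal.ofReal (1 - u) := by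
            rw [prob_compl_eq_one_sub hm, measure_cdf_le h hu1, ENNReal.ofReal_sub _ hu,
              ENNReal.ofReal_one]
    refine le_antisymm (le_of_forall_pos_le_add fun ε hε => ?_) zero_le
    rcases le_or_gt 1 ε with h1 | h1
    · exact prob_le_one.trans (by simpa using h1)
    · have hεt : ε ≠ ⊤ := (h1.trans ENNReal.one_lt_top).ne
      have h2 : ε.toReal < 1 := by
        rw [← ENNReal.toReal_one]; exact (ENNReal.toReal_lt_toReal hεt ENNReal.one_ne_top).2 h1
      have h3 : 0 < ε.toReal := ENNReal.toReal_pos hε.ne' hεt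
      refine (hle (1 - ε.toReal) (by linarith) (by linarith)).trans ?_
      rw [sub_sub_cancel, ENNReal.ofReal_toReal hεt, zero_add]
  filter_upwards [h0, h1] with x h0 h1
  exact ⟨h0.le, h1, fun _ => h0⟩

theorem measurableSet_cdfRange (δ : WithBot ℝ) : MeasurableSet (cdfRange δ) := by
  by_cases hδ : δ = ⊥
  · have : cdfRange δ = Ioo 0 1 := by
      ext u; simp [cdfRange, hδ]; constructor <;> rintro h <;> refine ⟨?_, ?_⟩ <;>
        first | linarith [h.1, h.2.1] | (try constructor) <;> linarith [h.1, h.2]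
    rw [this]; exact measurableSet_Ioo
  · have : cdfRange δ = Ico 0 1 := by
      ext u; simp [cdfRange, hδ]
    rw [this]; exact measurableSet_Ico

theorem aemeasurable_quantile_cdf (h : m ≪ volume.restrict (halfLine δ))
    (h' : volume.restrict (halfLine δ) ≪ m) (hν : ν ≪ volume.restrict (halfLine δ)) :
    AEMeasurable (fun x => quantile δ m (cdf ν x)) ν := by
  set B := {x | cdf ν x ∈ cdfRange δ}
  have hB : MeasurableSet B := (cdf ν).mono.measurable (measurableSet_cdfRange δ)
  have h1 : ν.restrict B = ν := Measure.restrict_eq_self_of_ae_mem (ae_cdf_mem_cdfRange hν)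
  have h2 := aemeasurable_restrict_of_monotoneOn (μ := ν) hB
    (f := fun x => quantile δ m (cdf ν x)) fun x hx y hy hxy =>
    (strictMonoOn_quantile h h').monotoneOn hx hy ((cdf ν).mono hxy)
  rwa [h1] at h2

/-- The monotone rearrangement `quantile δ m ∘ cdf ν` pushes `ν` forward to `m`. -/
theorem map_quantile_cdf (h : m ≪ volume.restrict (halfLine δ))
    (h' : volume.restrict (halfLine δ) ≪ m) (hν : ν ≪ volume.restrict (halfLine δ)) :
    ν.map (fun x => quantile δ m (cdf ν x)) = m := by
  have hK := aemeasurable_quantile_cdf h h' hν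
  have : IsProbabilityMeasure (ν.map fun x => quantile δ m (cdf ν x)) :=
    Measure.isProbabilityMeasure_map hK
  refine Measure.ext_of_Iic _ _ fun t => ?_
  rw [Measure.map_apply_of_aemeasurable hK measurableSet_Iic]
  by_cases ht : t ∈ halfLine δ
  · have h1 : (fun x => quantile δ m (cdf ν x)) ⁻¹' Iic t =ᵐ[ν] {x | cdf ν x ≤ cdf m t} := by
      filter_upwards [ae_cdf_mem_cdfRange hν] with x hx
      exact propext (quantile_le_iff h h' hx ht)
    rw [measure_congr h1, measure_cdf_le hν (cdf_lt_one h' t), ofReal_cdf]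
  · have h1 : (fun x => quantile δ m (cdf ν x)) ⁻¹' Iic t =ᵐ[ν] (∅ : Set ℝ) := by
      filter_upwards [ae_cdf_mem_cdfRange hν] with x hx
      exact propext ⟨fun hle => ht (halfLine_mono (quantile_mem h hx) hle), fun h => h.elim⟩
    rw [measure_congr h1, measure_empty, ← ofReal_cdf,
      cdf_eq_zero_of_notMem h fun y hy hyJ => ht (halfLine_mono hyJ hy.le), ENNReal.ofReal_zero]

end Quantile

/-! ### Quadratic transport cost on the line in terms of distribution functions. -/

section Crossing

/-- For two functions `A`, `B` in the role of the distribution functions `s ↦ P(X ≤ s)` and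
`t ↦ P(Y ≤ t)`, the least possible value of `E (X - Y)²`. -/
noncomputable def crossingCost (A B : ℝ → ℝ≥0∞) : ℝ≥0∞ :=
  2 * ∫⁻ z in {z : ℝ × ℝ | z.1 < z.2}, (A z.1 - B z.2) + (B z.1 - A z.2)

theorem measurableSet_fst_lt_snd : MeasurableSet {z : ℝ × ℝ | z.1 < z.2} :=
  measurableSet_lt measurable_fst measurable_snd

theorem volume_triangle {p q : ℝ} (hpq : p ≤ q) :
    volume {z : ℝ × ℝ | z.1 < z.2 ∧ p ≤ z.1 ∧ z.2 < q} = ENNReal.ofReal ((q - p) ^ 2 / 2) := by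
  have hm : MeasurableSet {z : ℝ × ℝ | z.1 < z.2 ∧ p ≤ z.1 ∧ z.2 < q} :=
    measurableSet_fst_lt_snd.inter ((measurableSet_le measurable_const measurable_fst).inter
      (measurableSet_lt measurable_snd measurable_const))
  rw [Measure.volume_eq_prod, Measure.prod_apply hm]
  -- The slice at s = p is split off as a null term, so that the rest lives on the half-open
  -- interval of the interval integral.
  have h1 : ∀ s : ℝ, volume (Prod.mk s ⁻¹' {z : ℝ × ℝ | z.1 < z.2 ∧ p ≤ z.1 ∧ z.2 < q}) =
      (Ioc p q).indicator (fun s => ENNReal.ofReal (q - s)) s + ({p} : Set ℝ).indicator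
        (fun s => ENNReal.ofReal (q - s)) s := by
    intro s
    by_cases hs : s ∈ Ioc p q
    · have hne : s ∉ ({p} : Set ℝ) := fun h => hs.1.ne' h
      rw [indicator_of_mem hs, indicator_of_notMem hne, add_zero, ← Real.volume_Ioo]
      congr 1
      ext t
      simp [hs.1.le]
    · by_cases hp : s = p
      · subst hp
        rw [indicator_of_notMem hs, indicator_of_mem (mem_singleton s), zero_add,
          ← Real.volume_Ioo]
        congr 1
        ext t
        simp
      · rw [indicator_of_notMem hs, indicator_of_notMem (by simpa using hp), zero_add]
        refine measure_mono_null (t := ∅) ?_ measure_empty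
        rintro t ⟨h1, h2, h3⟩
        simp only at h1 h2 h3
        exact hs ⟨lt_of_le_of_ne h2 (Ne.symm hp), (h1.trans h3).le⟩
  simp_rw [h1]
  rw [lintegral_add_right _ ((by fun_prop : Measurable _).indicator (measurableSet_singleton p)),
    lintegral_indicator measurableSet_Ioc, lintegral_indicator (measurableSet_singleton p)]
  rw [Measure.restrict_singleton]
  simp only [Real.volume_singleton, zero_smul, lintegral_zero_measure, add_zero]
  rw [← ofReal_integral_eq_lintegral_ofReal, ← intervalIntegral.integral_of_le hpq]
  · congr 1
    rw [intervalIntegral.integral_sub (by simp) (by simp), intervalIntegral.integral_const,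
      integral_id, smul_eq_mul]
    ring
  · exact (continuous_const.sub continuous_id).integrableOn_Ioc
  · filter_upwards [ae_restrict_mem measurableSet_Ioc] with s hs
    exact sub_nonneg.2 hs.2

/-- A layer-cake formula: the square is twice the area of a right triangle, and one of the two
triangles is always empty. By Tonelli it turns E(X−Y)² into an integral of the probabilities of X ≤
s < t < Y and Y ≤ s < t < X. -/
theorem ofReal_sq_sub_eq (p q : ℝ) :
    ENNReal.ofReal ((p - q) ^ 2) =
      2 * (volume {z : ℝ × ℝ | z.1 < z.2 ∧ p ≤ z.1 ∧ z.2 < q} +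
        volume {z : ℝ × ℝ | z.1 < z.2 ∧ q ≤ z.1 ∧ z.2 < p}) := by
  have hempty : ∀ {p q : ℝ}, q ≤ p → {z : ℝ × ℝ | z.1 < z.2 ∧ p ≤ z.1 ∧ z.2 < q} = ∅ := by
    intro p q h
    ext z
    simp only [mem_ofPred_eq, mem_empty_iff_false, iff_false]
    rintro ⟨h1, h2, h3⟩
    linarith
  have h2 : (2 : ℝ≥0∞) = ENNReal.ofReal 2 := by simp
  rcases le_total p q with h | h
  · rw [hempty h, measure_empty, add_zero, volume_triangle h, h2,
      ← ENNReal.ofReal_mul (by norm_num)]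
    congr 1; ring
  · rw [hempty h, measure_empty, zero_add, volume_triangle h, h2,
      ← ENNReal.ofReal_mul (by norm_num)]
    congr 1; ring

variable {Ω : Type*} [MeasurableSpace Ω] {P : Measure Ω} [IsFiniteMeasure P] {X Y : Ω → ℝ}

theorem measurableSet_between (hX : Measurable X) (hY : Measurable Y) :
    MeasurableSet {a : Ω × (ℝ × ℝ) | X a.1 ≤ a.2.1 ∧ a.2.2 < Y a.1} :=
  (measurableSet_le (hX.comp measurable_fst) (measurable_fst.comp measurable_snd)).inter
    (measurableSet_lt (measurable_snd.comp measurable_snd) (hY.comp measurable_fst))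

theorem measurableSet_lt_between (hX : Measurable X) (hY : Measurable Y) :
    MeasurableSet {a : Ω × (ℝ × ℝ) | a.2.1 < a.2.2 ∧ X a.1 ≤ a.2.1 ∧ a.2.2 < Y a.1} :=
  (measurable_snd measurableSet_fst_lt_snd).inter (measurableSet_between hX hY)

theorem lintegral_volume_triangle (hX : Measurable X) (hY : Measurable Y) :
    ∫⁻ x, volume {z : ℝ × ℝ | z.1 < z.2 ∧ X x ≤ z.1 ∧ z.2 < Y x} ∂P =
      ∫⁻ z in {z : ℝ × ℝ | z.1 < z.2}, P ({x | X x ≤ z.1} \ {x | Y x ≤ z.2}) := by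
  set S : Set (Ω × (ℝ × ℝ)) := {a | a.2.1 < a.2.2 ∧ X a.1 ≤ a.2.1 ∧ a.2.2 < Y a.1}
  have hS : MeasurableSet S := measurableSet_lt_between hX hY
  have h1 := Measure.prod_apply (μ := P) (ν := (volume : Measure (ℝ × ℝ))) hS
  rw [Measure.prod_apply_symm hS] at h1
  rw [← lintegral_indicator measurableSet_fst_lt_snd]
  refine h1.symm.trans (lintegral_congr fun z => ?_)
  by_cases hz : z.1 < z.2
  · rw [indicator_of_mem (by exact hz)]
    congr 1
    ext x
    simp [S, hz]
  · rw [indicator_of_notMem (by exact hz)]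
    refine measure_mono_null (t := ∅) ?_ measure_empty
    rintro x ⟨h, -⟩
    exact hz h

theorem lintegral_sq_sub_eq (hX : Measurable X) (hY : Measurable Y) :
    ∫⁻ x, ENNReal.ofReal ((X x - Y x) ^ 2) ∂P =
      2 * ∫⁻ z in {z : ℝ × ℝ | z.1 < z.2}, P ({x | X x ≤ z.1} \ {x | Y x ≤ z.2}) +
        P ({x | Y x ≤ z.1} \ {x | X x ≤ z.2}) := by
  have hm : ∀ {X Y : Ω → ℝ}, Measurable X → Measurable Y →
      Measurable fun z : ℝ × ℝ => P ({x | X x ≤ z.1} \ {x | Y x ≤ z.2}) := by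
    intro X Y hX hY
    have := measurable_measure_prodMk_right (μ := P) (measurableSet_between hX hY)
    convert! this using 3
    ext x
    simp
  have hm' : ∀ {X Y : Ω → ℝ}, Measurable X → Measurable Y →
      Measurable fun x => volume {z : ℝ × ℝ | z.1 < z.2 ∧ X x ≤ z.1 ∧ z.2 < Y x} := by
    intro X Y hX hY
    exact measurable_measure_prodMk_left (measurableSet_lt_between hX hY)
  simp_rw [ofReal_sq_sub_eq]
  rw [lintegral_const_mul' _ _ (by simp), lintegral_add_left (hm' hX hY),
    lintegral_volume_triangle hX hY, lintegral_volume_triangle hY hX,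
    lintegral_add_left (hm hX hY)]

/-- P(A \ B) ≥ P(A) − P(B), and the right side sees only the marginals; hence a lower bound valid
for every coupling. -/
theorem crossingCost_le_lintegral_sq_sub (hX : Measurable X) (hY : Measurable Y) :
    crossingCost (fun s => P {x | X x ≤ s}) (fun t => P {x | Y x ≤ t}) ≤
      ∫⁻ x, ENNReal.ofReal ((X x - Y x) ^ 2) ∂P := by
  rw [lintegral_sq_sub_eq hX hY, crossingCost]
  gcongr with z <;> exact le_measure_sdiff

/-- For comonotone `X` and `Y`, the distribution functions determine `E (X - Y)²`. -/
theorem lintegral_sq_sub_eq_crossingCost (hX : AEMeasurable X P) (hY : Measurable Y)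
    (h : ∀ s t, (∀ᵐ x ∂P, X x ≤ s → Y x ≤ t) ∨ ∀ᵐ x ∂P, Y x ≤ t → X x ≤ s) :
    ∫⁻ x, ENNReal.ofReal ((X x - Y x) ^ 2) ∂P =
      crossingCost (fun s => P {x | X x ≤ s}) (fun t => P {x | Y x ≤ t}) := by
  have hX' := hX.ae_eq_mk
  have h1 : ∀ s, P {x | X x ≤ s} = P {x | hX.mk X x ≤ s} := fun s => by
    refine measure_congr ?_
    filter_upwards [hX'] with x hx
    exact congrArg (· ≤ s) hx
  have h2 : ∫⁻ x, ENNReal.ofReal ((X x - Y x) ^ 2) ∂P =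
      ∫⁻ x, ENNReal.ofReal ((hX.mk X x - Y x) ^ 2) ∂P := by
    refine lintegral_congr_ae ?_
    filter_upwards [hX'] with x hx
    rw [hx]
  have h' : ∀ s t, (∀ᵐ x ∂P, hX.mk X x ≤ s → Y x ≤ t) ∨
      ∀ᵐ x ∂P, Y x ≤ t → hX.mk X x ≤ s := fun s t => by
    refine (h s t).imp (fun h => ?_) fun h => ?_ <;> filter_upwards [h, hX'] with x h hx
    · rwa [← hx]
    · rwa [← hx]
  simp_rw [h1, h2]
  have hXm := hX.measurable_mk
  generalize hX.mk X = Z at *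
  -- Comonotonicity means that the sublevel sets are nested up to null sets, and for nested sets P(A
  -- \ B) equals the truncated difference in either direction.
  have key : ∀ {Z Y : Ω → ℝ}, Measurable Z → Measurable Y → ∀ s t,
      ((∀ᵐ x ∂P, Z x ≤ s → Y x ≤ t) ∨ ∀ᵐ x ∂P, Y x ≤ t → Z x ≤ s) →
      P ({x | Z x ≤ s} \ {x | Y x ≤ t}) = P {x | Z x ≤ s} - P {x | Y x ≤ t} := by
    intro Z Y hZ hY s t h
    rcases h with h | h
    · have hle : {x | Z x ≤ s} ≤ᵐ[P] {x | Y x ≤ t} := h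
      rw [ae_le_set.1 hle, tsub_eq_zero_of_le (measure_mono_ae hle)]
    · have hle : {x | Y x ≤ t} ≤ᵐ[P] {x | Z x ≤ s} := h
      rw [measure_sdiff' _ (measurableSet_le hY measurable_const).nullMeasurableSet
        (measure_ne_top _ _)]
      congr 1
      refine measure_congr ?_
      filter_upwards [h] with x hx
      exact propext ⟨fun h => h.elim id hx, Or.inl⟩
  rw [lintegral_sq_sub_eq hXm hY, crossingCost]
  congr 1
  refine lintegral_congr fun z => ?_
  rw [key hXm hY _ _ (h' _ _), key hY hXm _ _ (h' _ _).symm]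

theorem measurable_crossing {A B : ℝ → ℝ≥0∞} (hA : Monotone A) (hB : Monotone B) :
    Measurable fun z : ℝ × ℝ => (A z.1 - B z.2) + (B z.1 - A z.2) := by
  have := hA.measurable
  have := hB.measurable
  fun_prop

/-- Fatou's lemma for the crossing cost. -/
theorem crossingCost_le_liminf {A B : ℝ → ℝ≥0∞} {B' : ℕ → ℝ → ℝ≥0∞} (hA : Monotone A)
    (hA' : ∀ s, A s ≠ ⊤) (hB : ∀ n, Monotone (B' n))
    (hlim : ∀ t, Tendsto (fun n => B' n t) atTop (𝓝 (B t))) :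
    crossingCost A B ≤ liminf (fun n => crossingCost A (B' n)) atTop := by
  have h1 : ∀ z : ℝ × ℝ, Tendsto (fun n => (A z.1 - B' n z.2) + (B' n z.1 - A z.2)) atTop
      (𝓝 ((A z.1 - B z.2) + (B z.1 - A z.2))) := fun z =>
    (ENNReal.Tendsto.sub tendsto_const_nhds (hlim _) (Or.inl (hA' _))).add
      (ENNReal.Tendsto.sub (hlim _) tendsto_const_nhds (Or.inr (hA' _)))
  have h2 : ∫⁻ z in {z : ℝ × ℝ | z.1 < z.2}, (A z.1 - B z.2) + (B z.1 - A z.2) ≤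
      liminf (fun n => ∫⁻ z in {z : ℝ × ℝ | z.1 < z.2},
        (A z.1 - B' n z.2) + (B' n z.1 - A z.2)) atTop := by
    refine le_trans (le_of_eq ?_) (lintegral_liminf_le fun n => measurable_crossing hA (hB n))
    exact lintegral_congr fun z => (h1 z).liminf_eq.symm
  unfold crossingCost
  rw [ENNReal.liminf_const_mul_of_ne_top (by simp)]
  gcongr

end Crossing

/-! ### Transfer of absolute continuity. -/

section AbsolutelyContinuous

theorem AbsolutelyContinuousOnInterval.of_dist_le {f F : ℝ → ℝ} {a b K : ℝ}
    (hF : AbsolutelyContinuousOnInterval F a b)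
    (h : ∀ x ∈ uIcc a b, ∀ y ∈ uIcc a b, dist (f x) (f y) ≤ K * dist (F x) (F y)) :
    AbsolutelyContinuousOnInterval f a b := by
  have h0 := Tendsto.const_mul K hF
  rw [mul_zero] at h0
  refine squeeze_zero' (Eventually.of_forall fun t =>
    Finset.sum_nonneg fun i _ => dist_nonneg) ?_ h0
  refine eventually_inf_principal.2 (Eventually.of_forall fun t ht => ?_)
  rw [Finset.mul_sum]
  refine Finset.sum_le_sum fun i hi => ?_
  have := ht.1 i hi
  exact h _ this.1 _ this.2

end AbsolutelyContinuous

/-- The measure on `[δ, ∞)` with density `g`. -/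
noncomputable def densityMeasure (δ : WithBot ℝ) (g : ℝ → ℝ) : Measure ℝ :=
  (volume.restrict (halfLine δ)).withDensity fun x => ENNReal.ofReal (g x)

theorem densityMeasure_absolutelyContinuous (δ : WithBot ℝ) (g : ℝ → ℝ) :
    densityMeasure δ g ≪ volume.restrict (halfLine δ) :=
  withDensity_absolutelyContinuous _ _

theorem absolutelyContinuous_densityMeasure {δ : WithBot ℝ} {g : ℝ → ℝ} (hg : Measurable g)
    (hpos : ∀ x, 0 < g x) : volume.restrict (halfLine δ) ≪ densityMeasure δ g :=
  withDensity_absolutelyContinuous' hg.ennreal_ofReal.aemeasurable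
    (Eventually.of_forall fun x => by simpa using hpos x)

theorem integrableOn_of_isProbabilityMeasure {δ : WithBot ℝ} {g : ℝ → ℝ} (hg : Measurable g)
    (h0 : ∀ x, 0 ≤ g x) [h : IsProbabilityMeasure (densityMeasure δ g)] :
    IntegrableOn g (halfLine δ) := by
  refine ⟨hg.aestronglyMeasurable, ?_⟩
  rw [hasFiniteIntegral_iff_ofReal (Eventually.of_forall h0)]
  have h1 := h.measure_univ
  rw [densityMeasure, withDensity_apply _ MeasurableSet.univ, Measure.restrict_univ] at h1
  rw [h1]
  exact ENNReal.one_lt_top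

theorem densityMeasure_apply_subset {δ : WithBot ℝ} {g : ℝ → ℝ} {s : Set ℝ} (hs : MeasurableSet s)
    (hsub : s ⊆ halfLine δ) : densityMeasure δ g s = ∫⁻ x in s, ENNReal.ofReal (g x) := by
  rw [densityMeasure, withDensity_apply _ hs, Measure.restrict_restrict hs,
    inter_eq_left.2 hsub]

/-! ### Distribution functions of measures with densities. -/

section Density

variable {δ : WithBot ℝ} {g : ℝ → ℝ} [IsProbabilityMeasure (densityMeasure δ g)]

theorem intervalIntegrable_density (hg : Measurable g) (h0 : ∀ x, 0 ≤ g x) {a b : ℝ}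
    (ha : a ∈ halfLine δ) (hb : b ∈ halfLine δ) : IntervalIntegrable g volume a b := by
  refine intervalIntegrable_iff.2 ((integrableOn_of_isProbabilityMeasure (δ := δ) hg h0).mono_set
    fun x hx => ?_)
  exact halfLine_mono (by rcases le_total a b with h | h <;> simpa [h]) hx.1.le

theorem cdf_eq_add_integral (hg : Measurable g) (h0 : ∀ x, 0 ≤ g x) {a b : ℝ}
    (ha : a ∈ halfLine δ) (hb : b ∈ halfLine δ) :
    cdf (densityMeasure δ g) b = cdf (densityMeasure δ g) a + ∫ x in a..b, g x := by
  have key : ∀ {a b : ℝ}, a ∈ halfLine δ → a ≤ b →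
      cdf (densityMeasure δ g) b - cdf (densityMeasure δ g) a = ∫ x in a..b, g x := by
    intro a b ha hab
    rw [cdf_real_sub _ _ hab, measureReal_def, densityMeasure_apply_subset measurableSet_Ioc
      (Ioc_subset_Icc_self.trans (Icc_subset_halfLine ha b)), intervalIntegral.integral_of_le hab,
      integral_eq_lintegral_of_nonneg_ae (Eventually.of_forall h0) hg.aestronglyMeasurable]
  rcases le_total a b with h | h
  · linarith [key ha h]
  · rw [intervalIntegral.integral_symm]
    linarith [key hb h]

theorem ae_hasDerivAt_cdf (hg : Measurable g) (h0 : ∀ x, 0 ≤ g x) {a b : ℝ}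
    (ha : a ∈ halfLine δ) (hab : a ≤ b) :
    ∀ᵐ x, x ∈ Icc a b → HasDerivAt (cdf (densityMeasure δ g)) (g x) x := by
  have hb := halfLine_mono ha hab
  have h1 : ∀ᵐ x : ℝ, x ≠ a := by simp [ae_iff, measure_singleton]
  filter_upwards [(intervalIntegrable_density hg h0 ha hb).ae_hasDerivAt_integral, h1]
    with x hx hxa hxI
  rw [uIcc_of_le hab] at hx
  refine ((hx hxI a (left_mem_Icc.2 hab)).const_add
    (cdf (densityMeasure δ g) a)).congr_of_eventuallyEq ?_
  filter_upwards [halfLine_mem_nhds ha (lt_of_le_of_ne hxI.1 (Ne.symm hxa))] with y hy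
  exact cdf_eq_add_integral hg h0 ha hy

theorem absolutelyContinuousOnInterval_cdf (hg : Measurable g) (h0 : ∀ x, 0 ≤ g x) {a b : ℝ}
    (ha : a ∈ halfLine δ) (hab : a ≤ b) :
    AbsolutelyContinuousOnInterval (cdf (densityMeasure δ g)) a b := by
  have hb := halfLine_mono ha hab
  refine AbsolutelyContinuousOnInterval.of_dist_le (K := 1)
    ((intervalIntegrable_density hg h0 ha
      hb).absolutelyContinuousOnInterval_intervalIntegral left_mem_uIcc) ?_
  intro x hx y hy
  rw [uIcc_of_le hab] at hx hy
  rw [cdf_eq_add_integral hg h0 ha (Icc_subset_halfLine ha b hx),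
    cdf_eq_add_integral hg h0 ha (Icc_subset_halfLine ha b hy), dist_add_left, one_mul]

end Density

/-! ### The Gaussian measure on the half-line. -/

section Gaussian

variable (δ : WithBot ℝ)

theorem exists_mem_halfLine : ∃ a, a ∈ halfLine δ := by
  induction δ with
  | bot => exact ⟨0, by simp [halfLine_bot]⟩
  | coe d => exact ⟨d, by simp [halfLine_coe]⟩

theorem integrable_exp_neg_sq_div_two : Integrable fun s : ℝ => Real.exp (-s ^ 2 / 2) := by
  convert! integrable_exp_neg_mul_sq (b := 1 / 2) (by norm_num) using 3
  ring

theorem gaussNorm_pos : 0 < gaussNorm δ := by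
  obtain ⟨a, ha⟩ := exists_mem_halfLine δ
  rw [gaussNorm, integral_pos_iff_support_of_nonneg (fun s => (Real.exp_pos _).le)
    integrable_exp_neg_sq_div_two.integrableOn]
  have hs : Function.support (fun s : ℝ => Real.exp (-s ^ 2 / 2)) = univ := by
    ext s; simp [Real.exp_ne_zero]
  rw [hs]
  exact measure_pos_of_Ioo_subset Measure.AbsolutelyContinuous.rfl ha (lt_add_one a)
    (subset_univ _)

/-- The density of the Gaussian measure restricted to `[δ, ∞)`. -/
noncomputable def gaussDensity (r : ℝ) : ℝ := Real.exp (-r ^ 2 / 2) / gaussNorm δ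

theorem gaussDensity_pos (r : ℝ) : 0 < gaussDensity δ r :=
  div_pos (Real.exp_pos _) (gaussNorm_pos δ)

theorem contDiff_gaussDensity : ContDiff ℝ ∞ (gaussDensity δ) := by
  unfold gaussDensity; fun_prop

theorem continuous_gaussDensity : Continuous (gaussDensity δ) :=
  (contDiff_gaussDensity δ).continuous

theorem hasDerivAt_gaussDensity (r : ℝ) :
    HasDerivAt (gaussDensity δ) (-r * gaussDensity δ r) r := by
  have h1 : HasDerivAt (fun r : ℝ => -r ^ 2 / 2) (-r) r := by
    convert! ((hasDerivAt_pow 2 r).neg.div_const 2) using 1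
    push_cast
    ring
  convert! (h1.exp.div_const (gaussNorm δ)) using 1
  rw [gaussDensity]; ring

/-- The normalized Gaussian measure on `[δ, ∞)`. -/
noncomputable abbrev gaussMeasure : Measure ℝ := densityMeasure δ (gaussDensity δ)

theorem integrable_gaussDensity : Integrable (gaussDensity δ) :=
  integrable_exp_neg_sq_div_two.div_const _

instance isProbabilityMeasure_gaussMeasure : IsProbabilityMeasure (gaussMeasure δ) := by
  refine ⟨?_⟩
  rw [gaussMeasure, densityMeasure, withDensity_apply _ MeasurableSet.univ,
    Measure.restrict_univ, ← ofReal_integral_eq_lintegral_ofReal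
    (integrable_gaussDensity δ).integrableOn
    (Eventually.of_forall fun r => (gaussDensity_pos δ r).le)]
  simp only [gaussDensity]
  rw [integral_div, ← gaussNorm, div_self (gaussNorm_pos δ).ne', ENNReal.ofReal_one]

theorem gaussMeasure_absolutelyContinuous : gaussMeasure δ ≪ volume.restrict (halfLine δ) :=
  densityMeasure_absolutelyContinuous _ _

theorem absolutelyContinuous_gaussMeasure : volume.restrict (halfLine δ) ≪ gaussMeasure δ :=
  absolutelyContinuous_densityMeasure (continuous_gaussDensity δ).measurable (gaussDensity_pos δ)

theorem cdf_eq_real_halfLine_inter {ν : Measure ℝ} [IsProbabilityMeasure ν]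
    (h : ν ≪ volume.restrict (halfLine δ)) (r : ℝ) : cdf ν r = ν.real (halfLine δ ∩ Iio r) := by
  rw [cdf_eq_real]
  refine measureReal_congr ?_
  have h1 : ∀ᵐ x ∂ν, x ≠ r := by
    rw [ae_iff]; exact h (by simp)
  filter_upwards [h1, ae_mem_halfLine h] with x hx hxJ
  exact propext ⟨fun hle => ⟨hxJ, lt_of_le_of_ne hle hx⟩, fun h => h.2.le⟩

theorem gaussCDF_eq_cdf : gaussCDF δ = cdf (gaussMeasure δ) := by
  ext r
  have hm := (measurableSet_halfLine δ).inter (measurableSet_Iio (a := r))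
  rw [cdf_eq_real_halfLine_inter δ (gaussMeasure_absolutelyContinuous δ), measureReal_def,
    densityMeasure_apply_subset hm inter_subset_left, ← integral_eq_lintegral_of_nonneg_ae
    (Eventually.of_forall fun r => (gaussDensity_pos δ r).le)
    (continuous_gaussDensity δ).aestronglyMeasurable]
  simp only [gaussDensity]
  rw [integral_div, gaussCDF]
  ring

theorem gaussCDFInv_eq_quantile : gaussCDFInv δ = quantile δ (gaussMeasure δ) := by
  rw [gaussCDFInv, gaussCDF_eq_cdf, quantile]

theorem hasDerivWithinAt_cdf_gaussMeasure {r : ℝ} (hr : r ∈ halfLine δ) :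
    HasDerivWithinAt (cdf (gaussMeasure δ)) (gaussDensity δ r) (halfLine δ) r := by
  have hc := continuous_gaussDensity δ
  have h1 : HasDerivAt (fun y => ∫ x in r..y, gaussDensity δ x) (gaussDensity δ r) r :=
    intervalIntegral.integral_hasDerivAt_right (by simp)
      hc.stronglyMeasurable.stronglyMeasurableAtFilter hc.continuousAt
  have h2 := fun y hy => cdf_eq_add_integral (δ := δ) hc.measurable
    (fun r => (gaussDensity_pos δ r).le) hr (b := y) hy
  exact (h1.const_add (cdf (gaussMeasure δ) r)).hasDerivWithinAt.congr h2 (h2 r hr)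

/-- On the compact interval between the two quantiles the Gaussian density has a positive minimum;
its inverse is a Lipschitz constant for the quantile function. -/
theorem exists_dist_quantile_le {u₁ u₂ : ℝ} (h₁ : u₁ ∈ cdfRange δ) (h₂ : u₂ ∈ cdfRange δ) :
    ∃ K : ℝ, ∀ u ∈ Icc u₁ u₂, ∀ v ∈ Icc u₁ u₂,
      dist (quantile δ (gaussMeasure δ) u) (quantile δ (gaussMeasure δ) v) ≤ K * dist u v := by
  have hγ := gaussMeasure_absolutelyContinuous δ
  have hγ' := absolutelyContinuous_gaussMeasure δ
  have hc := continuous_gaussDensity δ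
  set q := quantile δ (gaussMeasure δ)
  have hmem : ∀ u ∈ Icc u₁ u₂, u ∈ cdfRange δ := fun u hu =>
    ⟨h₁.1.trans hu.1, hu.2.trans_lt h₂.2.1, fun h => (h₁.2.2 h).trans_le hu.1⟩
  have hmono : MonotoneOn q (cdfRange δ) := (strictMonoOn_quantile hγ hγ').monotoneOn
  rcases lt_or_ge u₂ u₁ with hlt | hle
  · exact ⟨0, fun u hu => absurd (hu.1.trans hu.2) (not_le.2 hlt)⟩
  obtain ⟨z, -, hz⟩ := isCompact_Icc.exists_isMinOn
    (nonempty_Icc.2 (hmono h₁ h₂ hle)) hc.continuousOn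
  have hzpos := gaussDensity_pos δ z
  have key : ∀ u ∈ Icc u₁ u₂, ∀ v ∈ Icc u₁ u₂, u ≤ v →
      gaussDensity δ z * (q v - q u) ≤ v - u := by
    intro u hu v hv huv
    have hqu := quantile_mem hγ (hmem u hu)
    have hqv := quantile_mem hγ (hmem v hv)
    have hle := hmono (hmem u hu) (hmem v hv) huv
    have h1 := cdf_eq_add_integral (δ := δ) hc.measurable
      (fun r => (gaussDensity_pos δ r).le) hqu hqv
    rw [cdf_quantile hγ (hmem v hv), cdf_quantile hγ (hmem u hu)] at h1
    have h2 : ∫ _ in q u..q v, gaussDensity δ z ≤ ∫ x in q u..q v, gaussDensity δ x := by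
      refine intervalIntegral.integral_mono_on hle (by simp) (hc.intervalIntegrable _ _)
        fun x hx => hz ⟨?_, ?_⟩
      · exact (hmono h₁ (hmem u hu) hu.1).trans hx.1
      · exact hx.2.trans (hmono (hmem v hv) h₂ hv.2)
    rw [intervalIntegral.integral_const, smul_eq_mul] at h2
    linarith
  refine ⟨(gaussDensity δ z)⁻¹, fun u hu v hv => ?_⟩
  rw [← div_eq_inv_mul, le_div_iff₀ hzpos]
  rcases le_total u v with h | h
  · have h1 := key u hu v hv h
    rw [dist_comm, dist_comm u, Real.dist_eq, Real.dist_eq, abs_of_nonneg (sub_nonneg.2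
      (hmono (hmem u hu) (hmem v hv) h)), abs_of_nonneg (sub_nonneg.2 h)]
    linarith
  · have h1 := key v hv u hu h
    rw [Real.dist_eq, Real.dist_eq, abs_of_nonneg (sub_nonneg.2
      (hmono (hmem v hv) (hmem u hu) h)), abs_of_nonneg (sub_nonneg.2 h)]
    linarith

end Gaussian

/-- The monotone map from `ν` to the Gaussian measure on `[δ, ∞)`. -/
noncomputable def gaussMap (δ : WithBot ℝ) (ν : Measure ℝ) (x : ℝ) : ℝ :=
  quantile δ (gaussMeasure δ) (cdf ν x)

/-! ### The monotone map to the Gaussian measure and its Monge-Ampère equation. -/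

section GaussMap

variable {δ : WithBot ℝ} {g : ℝ → ℝ} [IsProbabilityMeasure (densityMeasure δ g)]

theorem absolutelyContinuousOnInterval_gaussMap (hg : Measurable g) (h0 : ∀ x, 0 ≤ g x) {a b : ℝ}
    (ha : a ∈ halfLine δ) (hab : a ≤ b) (hra : cdf (densityMeasure δ g) a ∈ cdfRange δ)
    (hrb : cdf (densityMeasure δ g) b ∈ cdfRange δ) :
    AbsolutelyContinuousOnInterval (gaussMap δ (densityMeasure δ g)) a b := by
  obtain ⟨K, hK⟩ := exists_dist_quantile_le δ hra hrb
  refine (absolutelyContinuousOnInterval_cdf hg h0 ha hab).of_dist_le (K := K) ?_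
  rw [uIcc_of_le hab]
  exact fun x hx y hy => hK _ ⟨(cdf _).mono hx.1, (cdf _).mono hx.2⟩ _
    ⟨(cdf _).mono hy.1, (cdf _).mono hy.2⟩

/-- The Monge-Ampère equation for the monotone map to the Gaussian measure. -/
theorem ae_deriv_gaussMap (hg : Measurable g) (h0 : ∀ x, 0 ≤ g x) {a b : ℝ}
    (ha : a ∈ halfLine δ) (hab : a ≤ b) (hra : cdf (densityMeasure δ g) a ∈ cdfRange δ)
    (hrb : cdf (densityMeasure δ g) b ∈ cdfRange δ) :
    ∀ᵐ x, x ∈ Icc a b → HasDerivAt (gaussMap δ (densityMeasure δ g))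
        (deriv (gaussMap δ (densityMeasure δ g)) x) x ∧
      deriv (gaussMap δ (densityMeasure δ g)) x *
        gaussDensity δ (gaussMap δ (densityMeasure δ g) x) = g x := by
  set ν := densityMeasure δ g
  have hγ := gaussMeasure_absolutelyContinuous δ
  have h1 : ∀ᵐ x : ℝ, x ≠ a := by simp [ae_iff, measure_singleton]
  have h2 : ∀ᵐ x : ℝ, x ≠ b := by simp [ae_iff, measure_singleton]
  filter_upwards [h1, h2, ae_hasDerivAt_cdf hg h0 ha hab,
    (absolutelyContinuousOnInterval_gaussMap hg h0 ha hab hra hrb).ae_differentiableAt]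
    with x hxa hxb hG hS hx
  rw [uIcc_of_le hab] at hS
  have hS' := (hS hx).hasDerivAt
  refine ⟨hS', ?_⟩
  have hr : ∀ y ∈ Icc a b, cdf ν y ∈ cdfRange δ := fun y hy =>
    ⟨cdf_nonneg _ _, ((cdf ν).mono hy.2).trans_lt hrb.2.1,
      fun h => (hra.2.2 h).trans_le ((cdf ν).mono hy.1)⟩
  have hnhds : Icc a b ∈ 𝓝 x :=
    Icc_mem_nhds (lt_of_le_of_ne hx.1 (Ne.symm hxa)) (lt_of_le_of_ne hx.2 hxb)
  -- Differentiating the identity `cdf γ ∘ S = cdf ν` avoids any derivative of the quantile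
  -- function. The chain rule is applied within [a, b], where S stays in the half-line.
  have h3 := (hasDerivWithinAt_cdf_gaussMeasure δ (quantile_mem hγ (hr x hx))).comp x
    (hS'.hasDerivWithinAt (s := Icc a b)) fun y hy => quantile_mem hγ (hr y hy)
  have h4 : HasDerivAt (cdf ν) (gaussDensity δ (gaussMap δ ν x) * deriv (gaussMap δ ν) x) x :=
    (h3.hasDerivAt hnhds).congr_of_eventuallyEq (by
      filter_upwards [hnhds] with y hy
      exact (cdf_quantile hγ (hr y hy)).symm)
  rw [mul_comm]
  exact h4.unique (hG hx)

end GaussMap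

/-! ### The optimal coupling for ρ and the form of the weight. -/

section Transport

variable {δ : WithBot ℝ} {V : ℝ → ℝ}

theorem expMeasure_eq_densityMeasure :
    expMeasure δ V = densityMeasure δ fun x => Real.exp (V x) := rfl

theorem expMeasure_absolutelyContinuous : expMeasure δ V ≪ volume.restrict (halfLine δ) :=
  densityMeasure_absolutelyContinuous _ _

theorem absolutelyContinuous_expMeasure (hV : Measurable V) :
    volume.restrict (halfLine δ) ≪ expMeasure δ V :=
  absolutelyContinuous_densityMeasure hV.exp fun _ => Real.exp_pos _

theorem aemeasurable_gaussMap {ν : Measure ℝ} [IsProbabilityMeasure ν]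
    (hν : ν ≪ volume.restrict (halfLine δ)) : AEMeasurable (gaussMap δ ν) ν :=
  aemeasurable_quantile_cdf (gaussMeasure_absolutelyContinuous δ)
    (absolutelyContinuous_gaussMeasure δ) hν

variable [hμ : IsProbabilityMeasure (expMeasure δ V)]

theorem expCDF_eq_cdf : expCDF δ V = cdf (expMeasure δ V) := by
  ext r
  rw [cdf_eq_real_halfLine_inter δ expMeasure_absolutelyContinuous, expCDF]

theorem transportMap_eq_gaussMap : transportMap δ V = gaussMap δ (expMeasure δ V) := by
  ext x
  rw [transportMap, gaussCDFInv_eq_quantile, expCDF_eq_cdf, gaussMap]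

theorem monotone_transportMap (hV : Measurable V) : Monotone (transportMap δ V) := by
  rw [transportMap_eq_gaussMap]
  intro x y hxy
  have h := absolutelyContinuous_expMeasure (δ := δ) hV
  exact (strictMonoOn_quantile (gaussMeasure_absolutelyContinuous δ)
    (absolutelyContinuous_gaussMeasure δ)).monotoneOn (cdf_mem_cdfRange h x)
    (cdf_mem_cdfRange h y) ((cdf _).mono hxy)

theorem strictMonoOn_transportMap (hV : Measurable V) :
    StrictMonoOn (transportMap δ V) (halfLine δ) := by
  rw [transportMap_eq_gaussMap]
  intro x hx y hy hxy
  have h := absolutelyContinuous_expMeasure (δ := δ) hV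
  exact strictMonoOn_quantile (gaussMeasure_absolutelyContinuous δ)
    (absolutelyContinuous_gaussMeasure δ) (cdf_mem_cdfRange h x)
    (cdf_mem_cdfRange h y) (strictMonoOn_cdf h hx hy hxy)

variable {ν : Measure ℝ} [IsProbabilityMeasure ν]

/-- Seen in the coordinate T, the rearrangement of ν onto μ is the map S. This is why the cost in ρ
becomes (S−T)². -/
theorem ae_transportMap_quantile (hν : ν ≪ volume.restrict (halfLine δ)) :
    ∀ᵐ x ∂ν, transportMap δ V (quantile δ (expMeasure δ V) (cdf ν x)) = gaussMap δ ν x := by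
  filter_upwards [ae_cdf_mem_cdfRange hν] with x hx
  rw [transportMap_eq_gaussMap, gaussMap, gaussMap,
    cdf_quantile expMeasure_absolutelyContinuous hx]

/-- Under ν, the maps S and T are comonotone, and S has the law that T has under μ. -/
theorem lintegral_transport_eq_crossingCost (hV : Measurable V)
    (hν : ν ≪ volume.restrict (halfLine δ)) :
    ∫⁻ x, ENNReal.ofReal ((gaussMap δ ν x - transportMap δ V x) ^ 2) ∂ν =
      crossingCost (fun s => expMeasure δ V {x | transportMap δ V x ≤ s})
        (fun t => ν {x | transportMap δ V x ≤ t}) := by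
  have hμ := expMeasure_absolutelyContinuous (δ := δ) (V := V)
  have hμ' := absolutelyContinuous_expMeasure (δ := δ) hV
  have hγ := gaussMeasure_absolutelyContinuous δ
  have hγ' := absolutelyContinuous_gaussMeasure δ
  have hT := monotone_transportMap (δ := δ) hV
  rw [lintegral_sq_sub_eq_crossingCost (aemeasurable_gaussMap hν) hT.measurable]
  · congr 1
    ext s
    have hm : MeasurableSet {x | transportMap δ V x ≤ s} :=
      measurableSet_le hT.measurable measurable_const
    conv_rhs => rw [← map_quantile_cdf hμ hμ' hν]
    rw [Measure.map_apply_of_aemeasurable (aemeasurable_quantile_cdf hμ hμ' hν) hm]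
    refine measure_congr ?_
    filter_upwards [ae_transportMap_quantile (V := V) hν] with x hx
    exact congrArg (· ≤ s) hx.symm
  · intro s t
    -- A counterexample x has S x ≤ s and T x > t. Every y with T y ≤ t then lies to the left of x,
    -- so S y ≤ S x ≤ s.
    by_cases h : ∀ x, cdf ν x ∈ cdfRange δ → gaussMap δ ν x ≤ s → transportMap δ V x ≤ t
    · left
      filter_upwards [ae_cdf_mem_cdfRange hν] with x hx using h x hx
    · right
      push Not at h
      obtain ⟨x, hx, hxs, hxt⟩ := h
      filter_upwards [ae_cdf_mem_cdfRange hν] with y hy hyt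
      have hyx : y ≤ x := le_of_not_gt fun hlt => absurd (hT hlt.le) (by linarith)
      exact le_trans ((strictMonoOn_quantile hγ hγ').monotoneOn hy hx ((cdf ν).mono hyx)) hxs

/-- The transport cost to `ν` is attained by the monotone coupling. -/
theorem wasserstein2_sq_eq (hV : Measurable V) (hν : ν ≪ volume.restrict (halfLine δ)) :
    wasserstein2 (transportDist δ V) (expMeasure δ V) ν ^ 2 =
      ∫⁻ x, ENNReal.ofReal ((gaussMap δ ν x - transportMap δ V x) ^ 2) ∂ν := by
  have hμ := expMeasure_absolutelyContinuous (δ := δ) (V := V)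
  have hμ' := absolutelyContinuous_expMeasure (δ := δ) hV
  have hT := (monotone_transportMap (δ := δ) hV).measurable
  have hsq : ∀ x y, transportDist δ V x y ^ 2 = (transportMap δ V x - transportMap δ V y) ^ 2 :=
    fun x y => sq_abs _
  rw [wasserstein2, ← ENNReal.rpow_natCast, ← ENNReal.rpow_mul]
  norm_num only [Nat.cast_ofNat, ENNReal.rpow_one]
  simp_rw [hsq]
  refine le_antisymm ?_ (le_iInf₂ fun π hπ => ?_)
  · have hK := aemeasurable_quantile_cdf hμ hμ' hν
    have hKid : AEMeasurable (fun x => (quantile δ (expMeasure δ V) (cdf ν x), x)) ν :=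
      hK.prodMk aemeasurable_id
    have hmem : (ν.map fun x => (quantile δ (expMeasure δ V) (cdf ν x), x)) ∈
        couplings (expMeasure δ V) ν := by
      constructor
      · rw [AEMeasurable.map_map_of_aemeasurable measurable_fst.aemeasurable hKid]
        exact map_quantile_cdf hμ hμ' hν
      · rw [AEMeasurable.map_map_of_aemeasurable measurable_snd.aemeasurable hKid]
        exact Measure.map_id
    refine (iInf₂_le _ hmem).trans (le_of_eq ?_)
    rw [lintegral_map' (by fun_prop) hKid]
    refine lintegral_congr_ae ?_
    filter_upwards [ae_transportMap_quantile (V := V) hν] with x hx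
    simp only [hx]
  · obtain ⟨h1, h2⟩ := hπ
    -- `couplings` does not ask π to be finite; its first marginal forces it.
    have : IsFiniteMeasure π := ⟨by
      rw [← preimage_univ (f := Prod.fst), ← Measure.map_apply measurable_fst MeasurableSet.univ,
        h1]
      exact measure_lt_top _ _⟩
    rw [lintegral_transport_eq_crossingCost hV hν]
    have hm : ∀ s, MeasurableSet {x | transportMap δ V x ≤ s} :=
      fun s => measurableSet_le hT measurable_const
    have h3 := crossingCost_le_lintegral_sq_sub (P := π) (hT.comp measurable_fst)
      (hT.comp measurable_snd)
    refine le_trans (le_of_eq ?_) h3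
    congr 1
    · ext s
      rw [← h1, Measure.map_apply measurable_fst (hm s)]
      rfl
    · ext s
      rw [← h2, Measure.map_apply measurable_snd (hm s)]
      rfl

theorem wasserstein2_sq_eq_crossingCost (hV : Measurable V)
    (hν : ν ≪ volume.restrict (halfLine δ)) :
    wasserstein2 (transportDist δ V) (expMeasure δ V) ν ^ 2 =
      crossingCost (fun s => expMeasure δ V {x | transportMap δ V x ≤ s})
        (fun t => ν {x | transportMap δ V x ≤ t}) := by
  rw [wasserstein2_sq_eq hV hν, lintegral_transport_eq_crossingCost hV hν]

/-- Zero cost forces S = T ν-almost everywhere, and T is injective on the half-line, so the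
rearrangement of ν onto μ is the identity ν-almost everywhere. -/
theorem eq_of_wasserstein2_eq_zero (hV : Measurable V) (hν : ν ≪ volume.restrict (halfLine δ))
    (h : wasserstein2 (transportDist δ V) (expMeasure δ V) ν = 0) : expMeasure δ V = ν := by
  have hμ := expMeasure_absolutelyContinuous (δ := δ) (V := V)
  have hμ' := absolutelyContinuous_expMeasure (δ := δ) hV
  have hT := (monotone_transportMap (δ := δ) hV).measurable
  have hS : AEMeasurable (fun x => gaussMap δ ν x - transportMap δ V x) ν :=
    (aemeasurable_gaussMap hν).sub hT.aemeasurable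
  have h1 := wasserstein2_sq_eq hV hν
  rw [h, zero_pow two_ne_zero] at h1
  rw [eq_comm, lintegral_eq_zero_iff' (hS.pow_const 2).ennreal_ofReal] at h1
  conv_lhs => rw [← map_quantile_cdf hμ hμ' hν]
  conv_rhs => rw [← Measure.map_id (μ := ν)]
  refine Measure.map_congr ?_
  filter_upwards [h1, ae_transportMap_quantile (V := V) hν, ae_cdf_mem_cdfRange hν,
    ae_mem_halfLine hν] with x hx hx' hxr hxJ
  simp only [Pi.zero_apply, ENNReal.ofReal_eq_zero] at hx
  refine (strictMonoOn_transportMap hV).injOn (quantile_mem hμ hxr) hxJ ?_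
  rw [hx']
  exact sub_eq_zero.1 (pow_eq_zero_iff two_ne_zero |>.1 (le_antisymm hx (sq_nonneg _)))

/-- V is only measurable, so φ' = e^V is available only at almost every point, by Lebesgue
differentiation. This suffices, because α enters only through integrals. -/
theorem ae_weight_eq (hV : Measurable V) {a b : ℝ} (ha : a ∈ halfLine δ) (hab : a ≤ b) :
    ∀ᵐ x, x ∈ Icc a b →
      weight δ V x = (gaussDensity δ (transportMap δ V x) / Real.exp (V x)) ^ 2 := by
  have : IsProbabilityMeasure (densityMeasure δ fun x => Real.exp (V x)) := hμ
  have h := ae_hasDerivAt_cdf (δ := δ) hV.exp (fun x => (Real.exp_pos (V x)).le) ha hab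
  filter_upwards [h] with x hx hxI
  have hJ := uniqueDiffOn_halfLine δ
  have hT : transportMap δ V x ∈ halfLine δ := by
    rw [transportMap_eq_gaussMap]
    exact quantile_mem (gaussMeasure_absolutelyContinuous δ)
      (cdf_mem_cdfRange (absolutelyContinuous_expMeasure hV) x)
  rw [weight, expCDF_eq_cdf, gaussCDF_eq_cdf, ← expCDF_eq_cdf, ← transportMap, expCDF_eq_cdf,
    expMeasure_eq_densityMeasure,
    (hasDerivWithinAt_cdf_gaussMeasure δ hT).derivWithin (hJ _ hT),
    ((hx hxI).hasDerivWithinAt).derivWithin (hJ _ (Icc_subset_halfLine ha b hxI))]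

end Transport

/-! ### Pointwise and integrated entropy bounds. -/

section Core

variable {δ : WithBot ℝ} {a b : ℝ} {S T h v : ℝ → ℝ}

/-- The quotient of the two Monge-Ampère equations; the Gaussian normalization cancels. -/
theorem log_eq_of_mongeAmpere {S' T' s t H v : ℝ} (hv : 0 < v) (hH : 0 < H)
    (hS : S' * gaussDensity δ s = H * v) (hT : T' * gaussDensity δ t = v) :
    0 < S' ∧ 0 < T' ∧ Real.log H = (t ^ 2 - s ^ 2) / 2 + Real.log (S' / T') := by
  have hs := gaussDensity_pos δ s
  have ht := gaussDensity_pos δ t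
  have hS' : 0 < S' := pos_of_mul_pos_left (hS ▸ mul_pos hH hv) hs.le
  have hT' : 0 < T' := pos_of_mul_pos_left (hT ▸ hv) ht.le
  refine ⟨hS', hT', ?_⟩
  have h1 : H = Real.exp ((t ^ 2 - s ^ 2) / 2) * (S' / T') := by
    have h2 : gaussDensity δ s = gaussDensity δ t * Real.exp ((t ^ 2 - s ^ 2) / 2) := by
      rw [gaussDensity, gaussDensity, div_mul_eq_mul_div, ← Real.exp_add]
      congr 2; ring
    rw [h2, ← hT] at hS
    have h3 : H * T' = S' * Real.exp ((t ^ 2 - s ^ 2) / 2) :=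
      mul_right_cancel₀ ht.ne' (by linarith)
    field_simp
    linarith
  rw [h1, Real.log_mul (Real.exp_pos _).ne' (div_pos hS' hT').ne', Real.log_exp]

/-- From log r ≤ r − 1 at r = S'/T'. The last term carries the density at t, which suits integration
by parts against h w(T). -/
theorem mul_log_le_of_mongeAmpere {S' T' s t H v : ℝ} (hv : 0 < v) (hH : 0 ≤ H)
    (hS : S' * gaussDensity δ s = H * v) (hT : T' * gaussDensity δ t = v) :
    v * (H * Real.log H) ≤ v * H * ((t ^ 2 - s ^ 2) / 2) +
      H * gaussDensity δ t * (S' - T') := by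
  rcases hH.eq_or_lt with rfl | hH
  · simp
  obtain ⟨hS', hT', h1⟩ := log_eq_of_mongeAmpere hv hH hS hT
  have h2 := Real.log_le_sub_one_of_pos (div_pos hS' hT')
  have h3 : H * gaussDensity δ t * (S' - T') = v * H * (S' / T' - 1) := by
    rw [← hT]; field_simp
  rw [h1, h3]
  have h4 := mul_le_mul_of_nonneg_left h2 (mul_pos hv hH).le
  linarith

/-- From log r ≥ 1 − 1/r at r = S'/T'. Now the density is taken at s, without the factor H, so that
no derivative will fall on the density h. -/
theorem le_mul_log_of_mongeAmpere {S' T' s t H v : ℝ} (hv : 0 < v) (hH : 0 ≤ H)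
    (hS : S' * gaussDensity δ s = H * v) (hT : T' * gaussDensity δ t = v) :
    v * H * ((t ^ 2 - s ^ 2) / 2) + gaussDensity δ s * (S' - T') ≤ v * (H * Real.log H) := by
  have hs := gaussDensity_pos δ s
  have ht := gaussDensity_pos δ t
  rcases hH.eq_or_lt with rfl | hH
  · have hT' : 0 < T' := pos_of_mul_pos_left (hT ▸ hv) ht.le
    have hS' : S' = 0 := by simpa [hs.ne'] using hS
    rw [hS']
    have := mul_pos hs hT'
    simp only [mul_zero, zero_mul]
    linarith
  obtain ⟨hS', hT', h1⟩ := log_eq_of_mongeAmpere hv hH hS hT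
  have h2 := Real.one_sub_inv_le_log_of_pos (div_pos hS' hT')
  have h3 : gaussDensity δ s * (S' - T') = v * H * (1 - (S' / T')⁻¹) := by
    rw [mul_comm v, ← hS]; field_simp
  rw [h1, h3]
  have h4 := mul_le_mul_of_nonneg_left h2 (mul_pos hv hH).le
  linarith

theorem AbsolutelyContinuousOnInterval.gaussDensity_comp
    (hS : AbsolutelyContinuousOnInterval S a b) :
    AbsolutelyContinuousOnInterval (fun x => gaussDensity δ (S x)) a b := by
  obtain ⟨C, hC⟩ := hS.exists_bound
  obtain ⟨K, hK⟩ := ((contDiff_gaussDensity δ).of_le (m := 1)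
    (by decide)).contDiffOn.exists_lipschitzOnWith (s := Icc (-C) C) (by decide)
    (convex_Icc _ _) isCompact_Icc
  have hmem : ∀ x ∈ uIcc a b, S x ∈ Icc (-C) C := fun x hx => abs_le.1 (hC x hx)
  exact hS.of_dist_le (K := K) fun x hx y hy => hK.dist_le_mul _ (hmem x hx) _ (hmem y hy)

/-- The entropy bound behind the HWI inequality, on a compact interval. -/
theorem integral_entropy_le (hab : a ≤ b) (hS : AbsolutelyContinuousOnInterval S a b)
    (hT : AbsolutelyContinuousOnInterval T a b) (hh : AbsolutelyContinuousOnInterval h a b)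
    (hh0 : ∀ x, 0 ≤ h x) (hv0 : ∀ x, 0 < v x) (hv : IntervalIntegrable v volume a b)
    (hS' : ∀ᵐ x, x ∈ Icc a b → HasDerivAt S (deriv S x) x ∧
      deriv S x * gaussDensity δ (S x) = h x * v x)
    (hT' : ∀ᵐ x, x ∈ Icc a b → HasDerivAt T (deriv T x) x ∧
      deriv T x * gaussDensity δ (T x) = v x) :
    ∫ x in a..b, v x * (h x * Real.log (h x)) ≤
      -(1 / 2) * (∫ x in a..b, v x * (h x * (S x - T x) ^ 2)) +
      (h b * gaussDensity δ (T b) * (S b - T b) - h a * gaussDensity δ (T a) * (S a - T a)) -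
      ∫ x in a..b, deriv h x * (gaussDensity δ (T x) * (S x - T x)) := by
  have hw : AbsolutelyContinuousOnInterval (fun x => gaussDensity δ (T x)) a b :=
    hT.gaussDensity_comp
  have hθ : AbsolutelyContinuousOnInterval (fun x => S x - T x) a b := hS.fun_sub hT
  have hhw : AbsolutelyContinuousOnInterval (fun x => h x * gaussDensity δ (T x)) a b :=
    hh.fun_mul hw
  -- The derivative moves from S−T onto h w(T). Since w(T)' = −T w(T) T' = −T v, a term T(S−T)
  -- appears, and (T²−S²)/2 + T(S−T) = −(S−T)²/2.
  have hibp := hhw.integral_mul_deriv_eq_deriv_mul hθ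
  have hcS := hS.continuousOn
  have hcT := hT.continuousOn
  have hch := hh.continuousOn
  have hcw := hw.continuousOn
  have hcθ := hθ.continuousOn
  have i1 : IntervalIntegrable (fun x => v x * (h x * Real.log (h x))) volume a b :=
    hv.mul_continuousOn (Real.continuous_mul_log.comp_continuousOn hch)
  have i2 : IntervalIntegrable (fun x => v x * (h x * ((T x ^ 2 - S x ^ 2) / 2))) volume a b :=
    hv.mul_continuousOn (by fun_prop)
  have i3 : IntervalIntegrable (fun x => h x * gaussDensity δ (T x) *
      deriv (fun x => S x - T x) x) volume a b :=
    hθ.intervalIntegrable_deriv.continuousOn_mul hhw.continuousOn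
  have i4 : IntervalIntegrable (fun x => v x * (h x * (T x * (S x - T x)))) volume a b :=
    hv.mul_continuousOn (by fun_prop)
  have i5 : IntervalIntegrable (fun x => deriv h x * (gaussDensity δ (T x) * (S x - T x)))
      volume a b := hh.intervalIntegrable_deriv.mul_continuousOn (by fun_prop)
  have e1 : ∫ x in a..b, deriv (fun x => h x * gaussDensity δ (T x)) x * (S x - T x) =
      (∫ x in a..b, deriv h x * (gaussDensity δ (T x) * (S x - T x))) -
        ∫ x in a..b, v x * (h x * (T x * (S x - T x))) := by
    rw [← intervalIntegral.integral_sub i5 i4]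
    refine intervalIntegral.integral_congr_ae ?_
    filter_upwards [hT', hh.ae_differentiableAt] with x hx hx' hxI
    rw [uIoc_of_le hab] at hxI
    rw [uIcc_of_le hab] at hx'
    obtain ⟨hxT, hxv⟩ := hx (Ioc_subset_Icc_self hxI)
    have hd := ((hx' (Ioc_subset_Icc_self hxI)).hasDerivAt.mul
      ((hasDerivAt_gaussDensity δ (T x)).comp x hxT)).deriv
    change deriv (fun x => h x * gaussDensity δ (T x)) x = _ at hd
    rw [hd, ← hxv]
    simp only [Function.comp_apply]
    ring
  have e2 : ∫ x in a..b, v x * (h x * Real.log (h x)) ≤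
      ∫ x in a..b, v x * (h x * ((T x ^ 2 - S x ^ 2) / 2)) + h x * gaussDensity δ (T x) *
        deriv (fun x => S x - T x) x := by
    refine intervalIntegral.integral_mono_ae_restrict hab i1 (i2.add i3) ?_
    filter_upwards [ae_restrict_of_ae hT', ae_restrict_of_ae hS',
      ae_restrict_mem measurableSet_Icc] with x hxT hxS hxI
    obtain ⟨hxT, hxv⟩ := hxT hxI
    obtain ⟨hxS, hxg⟩ := hxS hxI
    rw [(hxS.fun_sub hxT).deriv, ← mul_assoc (v x) (h x) ((T x ^ 2 - S x ^ 2) / 2)]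
    exact mul_log_le_of_mongeAmpere (hv0 x) (hh0 x) hxg hxv
  have e3 : ∫ x in a..b, v x * (h x * (S x - T x) ^ 2) =
      -2 * ((∫ x in a..b, v x * (h x * ((T x ^ 2 - S x ^ 2) / 2))) +
        ∫ x in a..b, v x * (h x * (T x * (S x - T x)))) := by
    rw [← intervalIntegral.integral_add i2 i4, ← intervalIntegral.integral_const_mul]
    refine intervalIntegral.integral_congr fun x _ => ?_
    ring
  rw [intervalIntegral.integral_add i2 i3, hibp, e1] at e2
  rw [e3]
  linarith

/-- The entropy bound behind the Talagrand inequality, on a compact interval. -/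
theorem integral_transport_le (hab : a ≤ b) (hS : AbsolutelyContinuousOnInterval S a b)
    (hT : AbsolutelyContinuousOnInterval T a b) (hh0 : ∀ x, 0 ≤ h x) (hv0 : ∀ x, 0 < v x)
    (hv : IntervalIntegrable (fun x => v x * h x) volume a b)
    (hent : IntervalIntegrable (fun x => v x * (h x * Real.log (h x))) volume a b)
    (hS' : ∀ᵐ x, x ∈ Icc a b → HasDerivAt S (deriv S x) x ∧
      deriv S x * gaussDensity δ (S x) = h x * v x)
    (hT' : ∀ᵐ x, x ∈ Icc a b → HasDerivAt T (deriv T x) x ∧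
      deriv T x * gaussDensity δ (T x) = v x) (ha : S a = T a) (hb : S b = T b) :
    ∫ x in a..b, v x * h x * (S x - T x) ^ 2 ≤
      2 * ∫ x in a..b, v x * (h x * Real.log (h x)) := by
  have hw : AbsolutelyContinuousOnInterval (fun x => gaussDensity δ (S x)) a b :=
    hS.gaussDensity_comp
  have hθ : AbsolutelyContinuousOnInterval (fun x => S x - T x) a b := hS.fun_sub hT
  -- Here w(S)' = −S w(S) S' = −S h v, and (T²−S²)/2 + S(S−T) = (S−T)²/2. The boundary terms vanish
  -- because S = T at both ends.
  have hibp := hw.integral_mul_deriv_eq_deriv_mul hθ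
  rw [ha, hb, sub_self, sub_self, mul_zero, mul_zero, sub_zero, zero_sub] at hibp
  have hcS := hS.continuousOn
  have hcT := hT.continuousOn
  have i2 : IntervalIntegrable (fun x => v x * h x * ((T x ^ 2 - S x ^ 2) / 2)) volume a b :=
    hv.mul_continuousOn (by fun_prop)
  have i3 : IntervalIntegrable (fun x => gaussDensity δ (S x) *
      deriv (fun x => S x - T x) x) volume a b :=
    hθ.intervalIntegrable_deriv.continuousOn_mul hw.continuousOn
  have i4 : IntervalIntegrable (fun x => v x * h x * (S x * (S x - T x))) volume a b :=
    hv.mul_continuousOn (by fun_prop)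
  have e1 : ∫ x in a..b, deriv (fun x => gaussDensity δ (S x)) x * (S x - T x) =
      -∫ x in a..b, v x * h x * (S x * (S x - T x)) := by
    rw [← intervalIntegral.integral_neg]
    refine intervalIntegral.integral_congr_ae ?_
    filter_upwards [hS'] with x hx hxI
    rw [uIoc_of_le hab] at hxI
    obtain ⟨hxS, hxv⟩ := hx (Ioc_subset_Icc_self hxI)
    have hd := ((hasDerivAt_gaussDensity δ (S x)).comp x hxS).deriv
    change deriv (fun x => gaussDensity δ (S x)) x = _ at hd
    rw [hd, mul_comm (v x), ← hxv]
    ring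
  have e2 : ∫ x in a..b, v x * h x * ((T x ^ 2 - S x ^ 2) / 2) + gaussDensity δ (S x) *
        deriv (fun x => S x - T x) x ≤ ∫ x in a..b, v x * (h x * Real.log (h x)) := by
    refine intervalIntegral.integral_mono_ae_restrict hab (i2.add i3) hent ?_
    filter_upwards [ae_restrict_of_ae hT', ae_restrict_of_ae hS',
      ae_restrict_mem measurableSet_Icc] with x hxT hxS hxI
    obtain ⟨hxT, hxv⟩ := hxT hxI
    obtain ⟨hxS, hxg⟩ := hxS hxI
    rw [(hxS.fun_sub hxT).deriv]
    exact le_mul_log_of_mongeAmpere (hv0 x) (hh0 x) hxg hxv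
  have e3 : ∫ x in a..b, v x * h x * (S x - T x) ^ 2 =
      2 * ((∫ x in a..b, v x * h x * ((T x ^ 2 - S x ^ 2) / 2)) +
        ∫ x in a..b, v x * h x * (S x * (S x - T x))) := by
    rw [← intervalIntegral.integral_add i2 i4, ← intervalIntegral.integral_const_mul]
    refine intervalIntegral.integral_congr fun x _ => ?_
    ring
  rw [intervalIntegral.integral_add i2 i3, hibp, e1] at e2
  rw [e3]
  linarith

end Core

/-! ### Exhaustion by compact intervals. -/

section Exhaustion

/-- The left end of the `n`-th interval of an exhaustion of `[δ, ∞)` by compact intervals. -/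
noncomputable def exhaustLeft (δ : WithBot ℝ) (n : ℕ) : ℝ := δ.recBotCoe (-(n : ℝ)) fun d => d

/-- The right end of the `n`-th interval of an exhaustion of `[δ, ∞)` by compact intervals. -/
noncomputable def exhaustRight (δ : WithBot ℝ) (n : ℕ) : ℝ := exhaustLeft δ 0 + n

/-- An exhaustion of `[δ, ∞)` by compact intervals. -/
noncomputable def exhaustion (δ : WithBot ℝ) (n : ℕ) : Set ℝ :=
  Icc (exhaustLeft δ n) (exhaustRight δ n)

variable (δ : WithBot ℝ)

theorem exhaustLeft_mem (n : ℕ) : exhaustLeft δ n ∈ halfLine δ := by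
  induction δ with
  | bot => simp [halfLine_bot]
  | coe d => simp [halfLine_coe, exhaustLeft]

theorem exhaustLeft_le_exhaustRight (n : ℕ) : exhaustLeft δ n ≤ exhaustRight δ n := by
  have : (0 : ℝ) ≤ n := n.cast_nonneg
  induction δ with
  | bot => simp only [exhaustRight, exhaustLeft, WithBot.recBotCoe_bot]; push_cast; linarith
  | coe d => simp [exhaustRight, exhaustLeft]

theorem tendsto_exhaustRight : Tendsto (exhaustRight δ) atTop atTop :=
  tendsto_atTop_add_const_left _ _ tendsto_natCast_atTop_atTop

theorem tendsto_exhaustLeft_bot : Tendsto (exhaustLeft ⊥) atTop atBot :=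
  tendsto_neg_atTop_atBot.comp tendsto_natCast_atTop_atTop

theorem eventually_mem_exhaustion {x : ℝ} (hx : x ∈ halfLine δ) :
    ∀ᶠ n in atTop, x ∈ exhaustion δ n := by
  have h1 := (tendsto_exhaustRight δ).eventually_ge_atTop x
  have h2 : ∀ᶠ n in atTop, exhaustLeft δ n ≤ x := by
    induction δ with
    | bot => exact tendsto_exhaustLeft_bot.eventually_le_atBot x
    | coe d =>
      refine Eventually.of_forall fun n => ?_
      rw [halfLine_coe] at hx
      simpa [exhaustLeft] using hx
  filter_upwards [h1, h2] with n h1 h2 using ⟨h2, h1⟩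

theorem aecover_exhaustion {ρ : Measure ℝ} (h : ρ ≪ volume.restrict (halfLine δ)) :
    AECover ρ atTop (exhaustion δ) where
  ae_eventually_mem := by
    filter_upwards [ae_mem_halfLine h] with x hx using eventually_mem_exhaustion δ hx
  measurableSet _ := measurableSet_Icc

theorem tendsto_measure_inter_exhaustion {ρ : Measure ℝ} (h : ρ ≪ volume.restrict (halfLine δ))
    (s : Set ℝ) :
    Tendsto (fun n => ρ (s ∩ exhaustion δ n)) atTop (𝓝 (ρ s)) := by
  have h1 := (aecover_exhaustion δ (Measure.restrict_le_self.absolutelyContinuous.trans h :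
    ρ.restrict s ≪ _)).lintegral_tendsto_of_countably_generated
    (f := fun _ => 1) aemeasurable_const
  simp only [lintegral_one, Measure.restrict_apply MeasurableSet.univ, univ_inter] at h1
  refine h1.congr fun n => ?_
  rw [inter_comm]; exact Measure.restrict_apply measurableSet_Icc

end Exhaustion

/-! ### Passing between μ and Lebesgue measure. -/

section WithDensity

variable {δ : WithBot ℝ} {V : ℝ → ℝ}

theorem withDensity_expMeasure (hV : Measurable V) {h : ℝ → ℝ} (hh : Measurable h) :
    (expMeasure δ V).withDensity (fun x => ENNReal.ofReal (h x)) =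
      densityMeasure δ fun x => h x * Real.exp (V x) := by
  rw [expMeasure, ← withDensity_mul _ hV.exp.ennreal_ofReal hh.ennreal_ofReal, densityMeasure]
  congr 1
  ext x
  rw [Pi.mul_apply, mul_comm (h x), ENNReal.ofReal_mul (Real.exp_pos _).le]

theorem restrict_expMeasure {s : Set ℝ} (hs : MeasurableSet s) (hsub : s ⊆ halfLine δ) :
    (expMeasure δ V).restrict s =
      (volume.restrict s).withDensity fun x => ENNReal.ofReal (Real.exp (V x)) := by
  rw [expMeasure, restrict_withDensity hs, Measure.restrict_restrict hs, inter_eq_left.2 hsub]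

theorem setIntegral_expMeasure (hV : Measurable V) {a b : ℝ} (ha : a ∈ halfLine δ) (hab : a ≤ b)
    (F : ℝ → ℝ) :
    ∫ x in Icc a b, F x ∂(expMeasure δ V) = ∫ x in a..b, Real.exp (V x) * F x := by
  rw [restrict_expMeasure measurableSet_Icc (Icc_subset_halfLine ha b),
    integral_withDensity_eq_integral_toReal_smul hV.exp.ennreal_ofReal (by simp),
    intervalIntegral.integral_of_le hab, integral_Icc_eq_integral_Ioc]
  simp [Real.exp_nonneg]

theorem integrableOn_expMeasure_iff (hV : Measurable V) {a b : ℝ} (ha : a ∈ halfLine δ)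
    (hab : a ≤ b) (F : ℝ → ℝ) :
    IntegrableOn F (Icc a b) (expMeasure δ V) ↔
      IntervalIntegrable (fun x => Real.exp (V x) * F x) volume a b := by
  rw [IntegrableOn, restrict_expMeasure measurableSet_Icc (Icc_subset_halfLine ha b),
    integrable_withDensity_iff_integrable_smul' hV.exp.ennreal_ofReal (by simp),
    intervalIntegrable_iff_integrableOn_Icc_of_le hab, IntegrableOn]
  simp [Real.exp_nonneg]

end WithDensity

/-! ### The Talagrand inequality at finite entropy. -/

section Talagrand

variable {δ : WithBot ℝ} {V : ℝ → ℝ} [hμ : IsProbabilityMeasure (expMeasure δ V)]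

theorem intervalIntegrable_exp (hV : Measurable V) {a b : ℝ} (ha : a ∈ halfLine δ)
    (hab : a ≤ b) : IntervalIntegrable (fun x => Real.exp (V x)) volume a b := by
  have := (integrableOn_expMeasure_iff (δ := δ) hV ha hab fun _ => 1).1
    (integrable_const _).integrableOn
  simpa using this

theorem transportMap_ae (hV : Measurable V) {a b : ℝ} (ha : a ∈ halfLine δ) (hab : a ≤ b) :
    AbsolutelyContinuousOnInterval (transportMap δ V) a b ∧
    ∀ᵐ x, x ∈ Icc a b → HasDerivAt (transportMap δ V) (deriv (transportMap δ V) x) x ∧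
      deriv (transportMap δ V) x * gaussDensity δ (transportMap δ V x) = Real.exp (V x) := by
  have : IsProbabilityMeasure (densityMeasure δ fun x => Real.exp (V x)) := hμ
  have hr := cdf_mem_cdfRange (absolutelyContinuous_expMeasure (δ := δ) hV)
  have h0 : ∀ x, 0 ≤ Real.exp (V x) := fun x => (Real.exp_pos _).le
  rw [transportMap_eq_gaussMap, expMeasure_eq_densityMeasure]
  exact ⟨absolutelyContinuousOnInterval_gaussMap hV.exp h0 ha hab (hr a) (hr b),
    ae_deriv_gaussMap hV.exp h0 ha hab (hr a) (hr b)⟩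

omit hμ in
theorem gaussMap_ae (hV : Measurable V) {h : ℝ → ℝ} (hh : Measurable h) (hh0 : ∀ x, 0 ≤ h x)
    [hν : IsProbabilityMeasure ((expMeasure δ V).withDensity fun x => ENNReal.ofReal (h x))]
    {a b : ℝ} (ha : a ∈ halfLine δ) (hab : a ≤ b)
    (hra : cdf ((expMeasure δ V).withDensity fun x => ENNReal.ofReal (h x)) a ∈ cdfRange δ)
    (hrb : cdf ((expMeasure δ V).withDensity fun x => ENNReal.ofReal (h x)) b ∈ cdfRange δ) :
    AbsolutelyContinuousOnInterval
      (gaussMap δ ((expMeasure δ V).withDensity fun x => ENNReal.ofReal (h x))) a b ∧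
    ∀ᵐ x, x ∈ Icc a b →
      HasDerivAt (gaussMap δ ((expMeasure δ V).withDensity fun x => ENNReal.ofReal (h x)))
        (deriv (gaussMap δ ((expMeasure δ V).withDensity fun x => ENNReal.ofReal (h x))) x) x ∧
      deriv (gaussMap δ ((expMeasure δ V).withDensity fun x => ENNReal.ofReal (h x))) x *
        gaussDensity δ
          (gaussMap δ ((expMeasure δ V).withDensity fun x => ENNReal.ofReal (h x)) x) =
        h x * Real.exp (V x) := by
  have hm : Measurable fun x => h x * Real.exp (V x) := hh.mul hV.exp
  have h0 : ∀ x, 0 ≤ h x * Real.exp (V x) := fun x => mul_nonneg (hh0 x) (Real.exp_pos _).le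
  rw [withDensity_expMeasure hV hh] at *
  exact ⟨absolutelyContinuousOnInterval_gaussMap hm h0 ha hab hra hrb,
    ae_deriv_gaussMap hm h0 ha hab hra hrb⟩

omit hμ in
theorem withDensity_absolutelyContinuous_halfLine (h : ℝ → ℝ≥0∞) :
    (expMeasure δ V).withDensity h ≪ volume.restrict (halfLine δ) :=
  (withDensity_absolutelyContinuous _ _).trans expMeasure_absolutelyContinuous

omit hμ in
theorem withDensity_eq_of_eqOn_one {h : ℝ → ℝ} {s : Set ℝ} (hs : MeasurableSet s)
    (h1 : ∀ x ∈ s, h x = 1) :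
    (expMeasure δ V).withDensity (fun x => ENNReal.ofReal (h x)) s = expMeasure δ V s := by
  rw [withDensity_apply _ hs, setLIntegral_congr_fun hs (g := fun _ => 1) fun x hx => by
    simp [h1 x hx], setLIntegral_one]

/-- The Talagrand inequality for densities equal to `1` off a compact interval. -/
theorem wasserstein2_sq_le_of_eq_one (hV : Measurable V) {h : ℝ → ℝ} (hh : Measurable h)
    (hh0 : ∀ x, 0 ≤ h x)
    [hν : IsProbabilityMeasure ((expMeasure δ V).withDensity fun x => ENNReal.ofReal (h x))]
    {a b : ℝ} (ha : a ∈ halfLine δ) (hab : a ≤ b) (h1 : ∀ x ∉ Icc a b, h x = 1)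
    (hint : IntegrableOn h (Icc a b) (expMeasure δ V))
    (hent : IntegrableOn (fun x => h x * Real.log (h x)) (Icc a b) (expMeasure δ V)) :
    wasserstein2 (transportDist δ V) (expMeasure δ V)
      ((expMeasure δ V).withDensity fun x => ENNReal.ofReal (h x)) ^ 2 ≤
      ENNReal.ofReal (2 * ∫ x in Icc a b, h x * Real.log (h x) ∂(expMeasure δ V)) := by
  set μ := expMeasure δ V
  set ν := μ.withDensity fun x => ENNReal.ofReal (h x) with hνdef
  have hν' : ν ≪ volume.restrict (halfLine δ) := withDensity_absolutelyContinuous_halfLine _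
  have hr := cdf_mem_cdfRange (absolutelyContinuous_expMeasure (δ := δ) hV)
  -- To the left of a the densities agree; to the right of b the complementary tails agree and both
  -- total masses are 1. Hence S = T off (a, b), which kills the boundary terms and confines the
  -- cost to [a, b].
  have hcdf : ∀ x, (x ≤ a ∨ b ≤ x) → cdf ν x = cdf μ x := by
    rintro x (hx | hx)
    · rw [cdf_eq_real_halfLine_inter δ hν',
        cdf_eq_real_halfLine_inter δ expMeasure_absolutelyContinuous, measureReal_def,
        measureReal_def, withDensity_eq_of_eqOn_one
          ((measurableSet_halfLine δ).inter measurableSet_Iio)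
          fun y hy => h1 y fun hyI => absurd hy.2 (not_lt.2 (hx.trans hyI.1))]
    · rw [cdf_eq_real, cdf_eq_real, ← compl_Ioi, probReal_compl_eq_one_sub measurableSet_Ioi,
        probReal_compl_eq_one_sub measurableSet_Ioi, measureReal_def, measureReal_def,
        withDensity_eq_of_eqOn_one measurableSet_Ioi
          fun y hy => h1 y fun hyI => absurd hy (not_lt.2 (hyI.2.trans hx))]
  have hST : ∀ x, (x ≤ a ∨ b ≤ x) → gaussMap δ ν x = transportMap δ V x := fun x hx => by
    rw [transportMap_eq_gaussMap, gaussMap, hcdf x hx, gaussMap]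
  obtain ⟨hTac, hT'⟩ := transportMap_ae hV ha hab
  obtain ⟨hSac, hS'⟩ := gaussMap_ae hV hh hh0 ha hab (by rw [hcdf a (Or.inl le_rfl)]; exact hr a)
    (by rw [hcdf b (Or.inr le_rfl)]; exact hr b)
  have hv := (integrableOn_expMeasure_iff hV ha hab _).1 hint
  have hθ : ContinuousOn (fun x => (gaussMap δ ν x - transportMap δ V x) ^ 2) (uIcc a b) :=
    (hSac.continuousOn.sub hTac.continuousOn).pow 2
  have hcore := integral_transport_le hab hSac hTac hh0 (fun x => Real.exp_pos (V x)) hv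
    ((integrableOn_expMeasure_iff hV ha hab _).1 hent) hS' hT' (hST a (Or.inl le_rfl))
    (hST b (Or.inr le_rfl))
  have hint2 : IntegrableOn (fun x => h x * (gaussMap δ ν x - transportMap δ V x) ^ 2) (Icc a b)
      μ := by
    rw [integrableOn_expMeasure_iff hV ha hab]
    refine (hv.mul_continuousOn hθ).congr fun x _ => ?_
    ring
  rw [wasserstein2_sq_eq hV hν', setIntegral_expMeasure hV ha hab]
  refine le_trans (le_of_eq ?_) (ENNReal.ofReal_le_ofReal hcore)
  have hae : ∀ x, ENNReal.ofReal (h x) * ENNReal.ofReal ((gaussMap δ ν x -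
      transportMap δ V x) ^ 2) = (Icc a b).indicator (fun x => ENNReal.ofReal (h x *
        (gaussMap δ ν x - transportMap δ V x) ^ 2)) x := by
    intro x
    by_cases hx : x ∈ Icc a b
    · rw [indicator_of_mem hx, ENNReal.ofReal_mul (hh0 x)]
    · rw [indicator_of_notMem hx, hST x, sub_self]
      · simp
      · by_contra hcon
        push Not at hcon
        exact hx ⟨hcon.1.le, hcon.2.le⟩
  conv_lhs => rw [hνdef]
  rw [lintegral_withDensity_eq_lintegral_mul_non_measurable _ hh.ennreal_ofReal (by simp)]
  simp only [Pi.mul_apply]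
  rw [lintegral_congr hae, lintegral_indicator measurableSet_Icc,
    ← ofReal_integral_eq_lintegral_ofReal hint2
      (Eventually.of_forall fun x => mul_nonneg (hh0 x) (sq_nonneg _)),
    setIntegral_expMeasure hV ha hab]
  congr 1
  refine intervalIntegral.integral_congr fun x _ => ?_
  ring

/-- The Talagrand inequality for densities with integrable entropy. -/
theorem wasserstein2_sq_le_of_integrable (hV : Measurable V) {h : ℝ → ℝ} (hh : Measurable h)
    (hh0 : ∀ x, 0 ≤ h x)
    [hν : IsProbabilityMeasure ((expMeasure δ V).withDensity fun x => ENNReal.ofReal (h x))]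
    (hint : Integrable h (expMeasure δ V))
    (hent : Integrable (fun x => h x * Real.log (h x)) (expMeasure δ V)) :
    wasserstein2 (transportDist δ V) (expMeasure δ V)
      ((expMeasure δ V).withDensity fun x => ENNReal.ofReal (h x)) ^ 2 ≤
      ENNReal.ofReal (2 * ∫ x, h x * Real.log (h x) ∂(expMeasure δ V)) := by
  set μ := expMeasure δ V
  set ν := μ.withDensity fun x => ENNReal.ofReal (h x) with hνdef
  have hμ' : μ ≪ volume.restrict (halfLine δ) := expMeasure_absolutelyContinuous
  have hν' : ν ≪ volume.restrict (halfLine δ) := withDensity_absolutelyContinuous_halfLine _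
  set I := exhaustion δ
  have hI : ∀ n, MeasurableSet (I n) := fun n => measurableSet_Icc
  have hμI : Tendsto (fun n => μ.real (I n)) atTop (𝓝 1) := by
    have := tendsto_measure_inter_exhaustion δ hμ' univ
    rw [measure_univ] at this
    simpa [measureReal_def, Function.comp_def, I] using
      (ENNReal.tendsto_toReal ENNReal.one_ne_top).comp this
  have hνI : Tendsto (fun n => ν.real (I n)) atTop (𝓝 1) := by
    have := tendsto_measure_inter_exhaustion δ hν' univ
    rw [measure_univ] at this
    simpa [measureReal_def, Function.comp_def, I] using
      (ENNReal.tendsto_toReal ENNReal.one_ne_top).comp this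
  -- With this factor, the density k h on I n gives I n the mass it has under μ, so the value 1
  -- elsewhere completes it to a probability density.
  set k : ℕ → ℝ := fun n => μ.real (I n) / ν.real (I n) with hk
  have hk1 : Tendsto k atTop (𝓝 1) := by
    have := hμI.div hνI one_ne_zero
    rwa [div_one] at this
  have hk0 : ∀ n, 0 ≤ k n := fun n => div_nonneg measureReal_nonneg measureReal_nonneg
  classical
  set H : ℕ → ℝ → ℝ := fun n => (I n).piecewise (fun x => k n * h x) fun _ => 1
  have hHm : ∀ n, Measurable (H n) := fun n =>
    (hh.const_mul _).piecewise (hI n) measurable_const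
  have hH0 : ∀ n x, 0 ≤ H n x := fun n x => by
    by_cases hx : x ∈ I n
    · simp only [H, piecewise_eq_of_mem _ _ _ hx]; exact mul_nonneg (hk0 n) (hh0 x)
    · simp only [H, piecewise_eq_of_notMem _ _ _ hx]; exact zero_le_one
  set N : ℕ → Measure ℝ := fun n => μ.withDensity fun x => ENNReal.ofReal (H n x)
  have hN : ∀ n {s : Set ℝ}, MeasurableSet s →
      N n s = ENNReal.ofReal (k n) * ν (s ∩ I n) + μ (s \ I n) := by
    intro n s hs
    rw [show N n s = ∫⁻ x in s, ENNReal.ofReal (H n x) ∂μ from withDensity_apply _ hs,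
      ← lintegral_inter_add_sdiff _ s (hI n), hνdef, withDensity_apply _ (hs.inter (hI n)),
      ← lintegral_const_mul _ hh.ennreal_ofReal]
    congr 1
    · refine setLIntegral_congr_fun (hs.inter (hI n)) fun x hx => ?_
      simp only [H, piecewise_eq_of_mem _ _ _ hx.2]
      rw [ENNReal.ofReal_mul (hk0 n)]
    · rw [setLIntegral_congr_fun (hs.diff (hI n)) (g := fun _ => 1) fun x hx => by
        simp only [H, piecewise_eq_of_notMem _ _ _ hx.2]; simp, setLIntegral_one]
  have hNlim : ∀ s : Set ℝ, MeasurableSet s → Tendsto (fun n => N n s) atTop (𝓝 (ν s)) := by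
    intro s hs
    simp_rw [hN _ hs]
    have t1 : Tendsto (fun n => ENNReal.ofReal (k n)) atTop (𝓝 1) := by
      simpa using ENNReal.tendsto_ofReal hk1
    have t2 := tendsto_measure_inter_exhaustion δ hν' s
    have t3 : Tendsto (fun n => μ (s \ I n)) atTop (𝓝 0) := by
      have h1 : ∀ n, μ (s \ I n) = μ s - μ (s ∩ I n) := fun n => by
        rw [← sdiff_self_inter, measure_sdiff inter_subset_left
          (hs.inter (hI n)).nullMeasurableSet (measure_ne_top _ _)]
      simp_rw [h1]
      simpa using ENNReal.Tendsto.sub tendsto_const_nhds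
        (tendsto_measure_inter_exhaustion δ hμ' s) (Or.inl (measure_ne_top μ s))
    simpa using (ENNReal.Tendsto.mul t1 (Or.inl one_ne_zero) t2
      (Or.inr ENNReal.one_ne_top)).add t3
  have hc : Tendsto (fun n => ENNReal.ofReal (2 * (k n * Real.log (k n) * ν.real (I n) +
      k n * ∫ x in I n, h x * Real.log (h x) ∂μ))) atTop
      (𝓝 (ENNReal.ofReal (2 * ∫ x, h x * Real.log (h x) ∂μ))) := by
    refine ENNReal.tendsto_ofReal (Tendsto.const_mul 2 ?_)
    have t1 := (Real.continuous_mul_log.tendsto 1).comp hk1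
    have t2 := (aecover_exhaustion δ hμ').integral_tendsto_of_countably_generated hent
    simpa using (t1.mul hνI).add (hk1.mul t2)
  have hcross : ∀ᶠ n in atTop, crossingCost (fun s => μ {x | transportMap δ V x ≤ s})
      (fun t => N n {x | transportMap δ V x ≤ t}) ≤
      ENNReal.ofReal (2 * (k n * Real.log (k n) * ν.real (I n) +
        k n * ∫ x in I n, h x * Real.log (h x) ∂μ)) := by
    -- Positivity of ν(I n) rules out the default value of the quotient k n; positivity of k n
    -- allows the logarithm of the product to be split.
    filter_upwards [hνI.eventually_const_lt one_pos, hk1.eventually_const_lt one_pos] with n hn hkn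
    have hprob : IsProbabilityMeasure (N n) := by
      refine ⟨?_⟩
      rw [hN n MeasurableSet.univ, univ_inter, ← ofReal_measureReal (μ := ν),
        ← ENNReal.ofReal_mul (hk0 n), hk, div_mul_cancel₀ _ hn.ne', ofReal_measureReal,
        ← compl_eq_univ_sdiff, measure_add_measure_compl (hI n), measure_univ]
    have hHI : ∀ x ∈ I n, H n x = k n * h x := fun x hx => piecewise_eq_of_mem _ _ _ hx
    have hlog : ∀ x ∈ I n, H n x * Real.log (H n x) =
        k n * Real.log (k n) * h x + k n * (h x * Real.log (h x)) := by
      intro x hx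
      rw [hHI x hx]
      rcases (hh0 x).eq_or_lt with h0 | h0
      · simp [← h0]
      · rw [Real.log_mul hkn.ne' h0.ne']; ring
    have i1 : IntegrableOn (fun x => k n * Real.log (k n) * h x) (I n) μ :=
      (hint.const_mul _).integrableOn
    have i2 : IntegrableOn (fun x => k n * (h x * Real.log (h x))) (I n) μ :=
      (hent.const_mul _).integrableOn
    have hle := wasserstein2_sq_le_of_eq_one hV (hHm n) (hH0 n) (exhaustLeft_mem δ n)
      (exhaustLeft_le_exhaustRight δ n) (fun x hx => piecewise_eq_of_notMem _ _ _ hx)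
      (((hint.const_mul (k n)).integrableOn (s := I n)).congr_fun
        (fun x hx => (hHI x hx).symm) (hI n))
      ((i1.add i2).congr_fun (fun x hx => (hlog x hx).symm) (hI n))
    rw [wasserstein2_sq_eq_crossingCost hV
      (withDensity_absolutelyContinuous_halfLine _)] at hle
    refine hle.trans (le_of_eq ?_)
    have hνr : ν.real (I n) = ∫ x in I n, h x ∂μ := by
      rw [measureReal_def, hνdef, withDensity_apply _ (hI n),
        integral_eq_lintegral_of_nonneg_ae (Eventually.of_forall hh0)
          hh.aestronglyMeasurable]
    rw [show Icc (exhaustLeft δ n) (exhaustRight δ n) = I n from rfl,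
      setIntegral_congr_fun (hI n) hlog, integral_add i1 i2, integral_const_mul,
      integral_const_mul, hνr]
  have hmono : ∀ ρ : Measure ℝ, Monotone fun t => ρ {x | transportMap δ V x ≤ t} :=
    fun ρ s t hst => measure_mono fun x hx => le_trans hx hst
  -- As a crossing cost, W² is lower semicontinuous under convergence of the distribution functions,
  -- so the bounds for the truncated densities pass to the limit.
  rw [wasserstein2_sq_eq_crossingCost hV hν']
  calc _ ≤ liminf (fun n => crossingCost (fun s => μ {x | transportMap δ V x ≤ s})
      (fun t => N n {x | transportMap δ V x ≤ t})) atTop :=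
        crossingCost_le_liminf (hmono μ) (fun s => measure_ne_top _ _) (fun n => hmono (N n))
          fun t => hNlim _ (measurableSet_le (monotone_transportMap hV).measurable
            measurable_const)
    _ ≤ liminf (fun n => ENNReal.ofReal (2 * (k n * Real.log (k n) * ν.real (I n) +
        k n * ∫ x in I n, h x * Real.log (h x) ∂μ))) atTop := liminf_le_liminf hcross
    _ = _ := hc.liminf_eq

end Talagrand

/-! ### Entropy as an extended real number. -/

section Entropy

variable {μ : Measure ℝ}

theorem extIntegral_of_integrable {g : ℝ → ℝ} (hg : Integrable g μ) :
    extIntegral μ g = ((∫ x, g x ∂μ : ℝ) : EReal) := by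
  have h1 : ∫⁻ x, ENNReal.ofReal (g x) ∂μ ≠ ⊤ := hg.lintegral_lt_top.ne
  have h2 : ∫⁻ x, ENNReal.ofReal (-g x) ∂μ ≠ ⊤ := hg.neg.lintegral_lt_top.ne
  rw [integral_eq_lintegral_pos_part_sub_lintegral_neg_part hg, extIntegral, EReal.coe_sub,
    EReal.coe_ennreal_toReal h1, EReal.coe_ennreal_toReal h2]

theorem neg_one_le_mul_log {t : ℝ} (ht : 0 ≤ t) : -1 ≤ t * Real.log t := by
  rcases ht.eq_or_lt with rfl | ht
  · simp
  have h1 := mul_le_mul_of_nonneg_left (Real.one_sub_inv_le_log_of_pos ht) ht.le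
  rw [mul_sub, mul_inv_cancel₀ ht.ne'] at h1
  linarith

theorem sqEntropy_congr {f g : ℝ → ℝ} (h : f =ᵐ[μ] g) : sqEntropy μ f = sqEntropy μ g := by
  rw [sqEntropy, sqEntropy, extIntegral, extIntegral]
  congr 2 <;> refine lintegral_congr_ae ?_ <;> filter_upwards [h] with x hx <;> rw [hx]

theorem sqDensity_congr {f g : ℝ → ℝ} (h : f =ᵐ[μ] g) : sqDensity μ f = sqDensity μ g := by
  refine withDensity_congr_ae ?_
  filter_upwards [h] with x hx
  rw [hx]

theorem sqEntropy_of_integrable {f : ℝ → ℝ}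
    (h : Integrable (fun x => f x ^ 2 * Real.log (f x ^ 2)) μ) :
    sqEntropy μ f = ((∫ x, f x ^ 2 * Real.log (f x ^ 2) ∂μ : ℝ) : EReal) :=
  extIntegral_of_integrable h

variable [IsProbabilityMeasure μ]

/-- The negative part of t log t is at most 1, hence integrable for a probability measure; only the
positive part can diverge. -/
theorem sqEntropy_eq_top_or_integrable {f : ℝ → ℝ} (hf : Measurable f) :
    sqEntropy μ f = ⊤ ∨ Integrable (fun x => f x ^ 2 * Real.log (f x ^ 2)) μ := by
  have hm : Measurable fun x => f x ^ 2 * Real.log (f x ^ 2) :=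
    (hf.pow_const 2).mul (hf.pow_const 2).log
  have hneg : ∫⁻ x, ENNReal.ofReal (-(f x ^ 2 * Real.log (f x ^ 2))) ∂μ ≤ 1 := by
    calc _ ≤ ∫⁻ _, 1 ∂μ := lintegral_mono fun x => by
          rw [← ENNReal.ofReal_one]
          exact ENNReal.ofReal_le_ofReal (by linarith [neg_one_le_mul_log (sq_nonneg (f x))])
      _ = 1 := by simp
  by_cases htop : ∫⁻ x, ENNReal.ofReal (f x ^ 2 * Real.log (f x ^ 2)) ∂μ = ⊤
  · left
    rw [sqEntropy, extIntegral, htop, EReal.coe_ennreal_top]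
    refine EReal.top_sub ?_
    simpa using (hneg.trans_lt ENNReal.one_lt_top).ne
  · right
    refine ⟨hm.aestronglyMeasurable, ?_⟩
    have h1 : ∀ x, ‖f x ^ 2 * Real.log (f x ^ 2)‖ₑ =
        ENNReal.ofReal (f x ^ 2 * Real.log (f x ^ 2)) +
          ENNReal.ofReal (-(f x ^ 2 * Real.log (f x ^ 2))) := by
      intro x
      rw [Real.enorm_eq_ofReal_abs]
      rcases le_total 0 (f x ^ 2 * Real.log (f x ^ 2)) with h | h
      · rw [abs_of_nonneg h, ENNReal.ofReal_of_nonpos (neg_nonpos.2 h), add_zero]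
      · rw [abs_of_nonpos h, ENNReal.ofReal_of_nonpos h, zero_add]
    rw [HasFiniteIntegral, lintegral_congr h1, lintegral_add_left hm.ennreal_ofReal]
    exact ENNReal.add_lt_top.2 ⟨lt_top_iff_ne_top.2 htop, hneg.trans_lt ENNReal.one_lt_top⟩

omit [IsProbabilityMeasure μ] in
theorem isProbabilityMeasure_sqDensity {f : ℝ → ℝ} (h : ∫ x, f x ^ 2 ∂μ = 1) :
    Integrable (fun x => f x ^ 2) μ ∧ IsProbabilityMeasure (sqDensity μ f) := by
  have hint : Integrable (fun x => f x ^ 2) μ := by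
    -- The Bochner integral of a non-integrable function is 0 by convention, so the value 1 already
    -- gives integrability.
    by_contra hcon
    rw [integral_undef hcon] at h
    exact zero_ne_one h
  refine ⟨hint, ⟨?_⟩⟩
  rw [sqDensity, withDensity_apply _ MeasurableSet.univ, Measure.restrict_univ,
    ← ofReal_integral_eq_lintegral_ofReal hint (Eventually.of_forall fun x => sq_nonneg _), h,
    ENNReal.ofReal_one]

end Entropy

theorem talagrand_inequality {δ : WithBot ℝ} {V : ℝ → ℝ} (hV : Measurable V)
    [hμ : IsProbabilityMeasure (expMeasure δ V)] {f : ℝ → ℝ}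
    (hf : AEMeasurable f (expMeasure δ V)) (h1 : ∫ x, f x ^ 2 ∂(expMeasure δ V) = 1) :
    ((wasserstein2 (transportDist δ V) (expMeasure δ V)
      (sqDensity (expMeasure δ V) f) ^ 2 : ℝ≥0∞) : EReal) ≤
        2 * sqEntropy (expMeasure δ V) f := by
  have hfg := hf.ae_eq_mk
  have hg := hf.measurable_mk
  have h1' : ∫ x, hf.mk f x ^ 2 ∂(expMeasure δ V) = 1 := by
    rw [← h1]
    refine integral_congr_ae ?_
    filter_upwards [hfg] with x hx
    rw [hx]
  rw [sqEntropy_congr hfg, sqDensity_congr hfg]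
  generalize hf.mk f = g at *
  obtain ⟨hint, hprob⟩ := isProbabilityMeasure_sqDensity h1'
  rcases sqEntropy_eq_top_or_integrable (μ := expMeasure δ V) hg with h | h
  · rw [h, EReal.mul_top_of_pos (by norm_num)]
    exact le_top
  · have : IsProbabilityMeasure ((expMeasure δ V).withDensity fun x => ENNReal.ofReal (g x ^ 2)) :=
      hprob
    have hle := wasserstein2_sq_le_of_integrable hV (hg.pow_const 2) (fun x => sq_nonneg _) hint h
    -- Nonnegativity of the entropy, by integrating t log t ≥ t − 1; without it `ENNReal.ofReal`
    -- could truncate the bound.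
    have h0 : 0 ≤ 2 * ∫ x, g x ^ 2 * Real.log (g x ^ 2) ∂(expMeasure δ V) := by
      have h2 := integral_mono (μ := expMeasure δ V) (hint.sub (integrable_const 1)) h fun x => by
        rcases (sq_nonneg (g x)).eq_or_lt with h0 | h0
        · simp [← h0]
        · have h3 := mul_le_mul_of_nonneg_left (Real.one_sub_inv_le_log_of_pos h0) h0.le
          rw [mul_sub, mul_inv_cancel₀ h0.ne'] at h3
          simpa using h3
      simp only [Pi.sub_apply] at h2
      rw [integral_sub hint (integrable_const 1), h1'] at h2
      simp only [integral_const, probReal_univ, smul_eq_mul, mul_one, sub_self] at h2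
      linarith
    rw [sqEntropy_of_integrable h]
    calc _ ≤ ((ENNReal.ofReal (2 * ∫ x, g x ^ 2 * Real.log (g x ^ 2) ∂(expMeasure δ V)) :
          ℝ≥0∞) : EReal) := EReal.coe_ennreal_le_coe_ennreal_iff.2 hle
      _ = _ := by
        rw [EReal.coe_ennreal_ofReal, max_eq_left h0, EReal.coe_mul]
        rfl

/-! ### Gaussian tails. -/

section GaussTail

variable (δ : WithBot ℝ)

theorem gaussTail_pos (t : ℝ) : 0 < ∫ x in Ioi t, gaussDensity δ x := by
  have h : (fun x => (0 : ℝ)) < gaussDensity δ := by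
    refine lt_of_le_of_ne (fun x => (gaussDensity_pos δ x).le) fun h => ?_
    exact (gaussDensity_pos δ 0).ne (congrFun h 0)
  rw [integral_pos_iff_support_of_nonneg (fun x => (gaussDensity_pos δ x).le)
    (integrable_gaussDensity δ).integrableOn]
  have hs : Function.support (gaussDensity δ) = univ := by
    ext s; simp [(gaussDensity_pos δ s).ne']
  rw [hs, Measure.restrict_apply_univ, Real.volume_Ioi]
  exact ENNReal.zero_lt_top

/-- After a shift by d, use (x+d)² ≥ x² + d² for x, d ≥ 0. -/
theorem gaussTail_le {t d : ℝ} (ht : 0 ≤ t) (hd : 0 ≤ d) :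
    ∫ x in Ioi (t + d), gaussDensity δ x ≤
      Real.exp (-d ^ 2 / 2) * ∫ x in Ioi t, gaussDensity δ x := by
  have h1 : ∫ x in Ioi (t + d), gaussDensity δ x = ∫ x in Ioi t, gaussDensity δ (x + d) := by
    rw [← integral_indicator measurableSet_Ioi, ← integral_indicator measurableSet_Ioi,
      ← integral_add_right_eq_self _ d]
    refine integral_congr_ae (Eventually.of_forall fun x => ?_)
    simp only [indicator, mem_Ioi, add_lt_add_iff_right]
  rw [h1, ← integral_const_mul]
  refine setIntegral_mono_on ((integrable_gaussDensity δ).comp_add_right d).integrableOn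
    ((integrable_gaussDensity δ).integrableOn.const_mul _) measurableSet_Ioi fun x hx => ?_
  rw [gaussDensity, gaussDensity, ← mul_div_assoc, ← Real.exp_add]
  refine div_le_div_of_nonneg_right (Real.exp_le_exp.2 ?_) (gaussNorm_pos δ).le
  have := mul_nonneg (ht.trans (le_of_lt hx)) hd
  nlinarith

/-- A shift by d = s − t ≥ 0 shrinks the tail by at least e^{−d²/2}; if the loss is no worse than ε,
then ε ≤ e^{−d²/2}. -/
theorem sub_le_of_gaussTail_le {t s ε : ℝ} (ht : 0 ≤ t) (hε : 0 < ε)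
    (h : ε * ∫ x in Ioi t, gaussDensity δ x ≤ ∫ x in Ioi s, gaussDensity δ x) :
    s - t ≤ Real.sqrt (2 * Real.log ε⁻¹) := by
  rcases le_total s t with hst | hst
  · exact (sub_nonpos.2 hst).trans (Real.sqrt_nonneg _)
  refine Real.le_sqrt_of_sq_le ?_
  have h1 := gaussTail_le δ ht (sub_nonneg.2 hst)
  rw [add_sub_cancel] at h1
  have h2 := le_of_mul_le_mul_right (h.trans h1) (gaussTail_pos δ t)
  have h3 := Real.log_le_log hε h2
  rw [Real.log_exp] at h3
  rw [Real.log_inv]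
  linarith

theorem one_sub_cdf_gaussMeasure {s : ℝ} (hs : s ∈ halfLine δ) :
    1 - cdf (gaussMeasure δ) s = ∫ x in Ioi s, gaussDensity δ x := by
  rw [cdf_eq_real, ← probReal_compl_eq_one_sub measurableSet_Iic, compl_Iic, measureReal_def,
    densityMeasure_apply_subset measurableSet_Ioi fun x hx => halfLine_mono hs (le_of_lt hx),
    integral_eq_lintegral_of_nonneg_ae
      (Eventually.of_forall fun x => (gaussDensity_pos δ x).le)
      (continuous_gaussDensity δ).aestronglyMeasurable]

theorem cdf_gaussMeasure_bot (s : ℝ) :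
    cdf (gaussMeasure ⊥) s = ∫ x in Ioi (-s), gaussDensity ⊥ x := by
  rw [cdf_eq_real, measureReal_def, densityMeasure_apply_subset measurableSet_Iic (by
    simp [halfLine_bot]), ← integral_eq_lintegral_of_nonneg_ae
      (Eventually.of_forall fun x => (gaussDensity_pos ⊥ x).le)
      (continuous_gaussDensity ⊥).aestronglyMeasurable, ← integral_comp_neg_Iic]
  simp [gaussDensity]

theorem tendsto_gaussDensity_atTop : Tendsto (gaussDensity δ) atTop (𝓝 0) := by
  have h1 : Tendsto (fun r : ℝ => -r ^ 2 / 2) atTop atBot := by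
    have := (tendsto_pow_atTop (α := ℝ) two_ne_zero).atTop_div_const (r := 2) (by norm_num)
    refine (tendsto_neg_atTop_atBot.comp this).congr fun r => ?_
    simp only [Function.comp_apply]; ring
  have h2 := (Real.tendsto_exp_atBot.comp h1).div_const (gaussNorm δ)
  rwa [zero_div] at h2

theorem gaussDensity_neg (r : ℝ) : gaussDensity δ (-r) = gaussDensity δ r := by
  simp [gaussDensity]

end GaussTail

/-- At s < t, each term either decreases when B is replaced by B' or vanishes, because A(s) ≤ A(t).
Applied to B' = (1−ε)B + εA, it shows that mixing ν with μ does not increase the distance to μ. -/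
theorem crossingCost_le_of_between {A B B' : ℝ → ℝ≥0∞} (hA : Monotone A)
    (h1 : ∀ t, min (A t) (B t) ≤ B' t) (h2 : ∀ t, B' t ≤ max (A t) (B t)) :
    crossingCost A B' ≤ crossingCost A B := by
  unfold crossingCost
  refine mul_le_mul_right (setLIntegral_mono' measurableSet_fst_lt_snd fun z hz => ?_) 2
  have hz' : A z.1 ≤ A z.2 := hA (le_of_lt hz)
  refine add_le_add ?_ ?_
  · rw [tsub_le_iff_right]
    rcases le_total (A z.2) (B z.2) with h | h
    · exact hz'.trans (((min_eq_left h).symm.le.trans (h1 _)).trans le_add_self)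
    · exact le_tsub_add.trans (by gcongr; exact (min_eq_right h).symm.le.trans (h1 _))
  · rw [tsub_le_iff_right]
    refine (h2 _).trans (max_le (hz'.trans le_add_self) le_tsub_add)

/-! ### Densities bounded below: control of S − T near the ends. -/

section LowerBound

variable {δ : WithBot ℝ} {V : ℝ → ℝ} [hμ : IsProbabilityMeasure (expMeasure δ V)]

theorem tendsto_transportMap_atTop (hV : Measurable V) :
    Tendsto (transportMap δ V) atTop atTop := by
  refine tendsto_atTop.2 fun M => ?_
  obtain ⟨c, hc⟩ := exists_mem_halfLine δ
  have hγ' := absolutelyContinuous_gaussMeasure δ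
  have hy : max c M ∈ halfLine δ := halfLine_mono hc (le_max_left _ _)
  filter_upwards [(tendsto_cdf_atTop (expMeasure δ V)).eventually_const_lt
    (cdf_lt_one hγ' (max c M))] with x hx
  rw [transportMap_eq_gaussMap, gaussMap]
  refine (le_max_right c M).trans ?_
  conv_lhs => rw [← quantile_cdf hγ' hy]
  exact (strictMonoOn_quantile (gaussMeasure_absolutelyContinuous δ) hγ').monotoneOn
    (cdf_mem_cdfRange hγ' _) (cdf_mem_cdfRange (absolutelyContinuous_expMeasure hV) _) hx.le

theorem tendsto_transportMap_atBot {V : ℝ → ℝ} [hμ : IsProbabilityMeasure (expMeasure ⊥ V)]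
    (hV : Measurable V) : Tendsto (transportMap ⊥ V) atBot atBot := by
  refine tendsto_atBot.2 fun M => ?_
  have hγ' := absolutelyContinuous_gaussMeasure ⊥
  have hM : M ∈ halfLine ⊥ := by simp [halfLine_bot]
  filter_upwards [(tendsto_cdf_atBot (expMeasure ⊥ V)).eventually_lt_const
    ((cdf_mem_cdfRange hγ' M).2.2 rfl)] with x hx
  rw [transportMap_eq_gaussMap, gaussMap]
  conv_rhs => rw [← quantile_cdf hγ' hM]
  exact (strictMonoOn_quantile (gaussMeasure_absolutelyContinuous ⊥) hγ').monotoneOn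
    (cdf_mem_cdfRange (absolutelyContinuous_expMeasure hV) _) (cdf_mem_cdfRange hγ' _) hx.le

variable {ν : Measure ℝ} [hν : IsProbabilityMeasure ν] {ε : ℝ}

theorem mul_cdf_le (h : ∀ s, MeasurableSet s → ε * (expMeasure δ V).real s ≤ ν.real s) (x : ℝ) :
    ε * cdf (expMeasure δ V) x ≤ cdf ν x ∧ ε * (1 - cdf (expMeasure δ V) x) ≤ 1 - cdf ν x := by
  rw [cdf_eq_real, cdf_eq_real, ← probReal_compl_eq_one_sub measurableSet_Iic,
    ← probReal_compl_eq_one_sub measurableSet_Iic]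
  exact ⟨h _ measurableSet_Iic, h _ measurableSet_Iic.compl⟩

/-- Because ν dominates εμ, its distribution function avoids the excluded extreme values everywhere,
so S is a genuine quantile at every point. -/
theorem cdf_mem_cdfRange_of_le (hV : Measurable V) (hε : 0 < ε)
    (h : ∀ s, MeasurableSet s → ε * (expMeasure δ V).real s ≤ ν.real s) (x : ℝ) :
    cdf ν x ∈ cdfRange δ := by
  obtain ⟨h1, h2⟩ := mul_cdf_le h x
  obtain ⟨-, h4, h5⟩ := cdf_mem_cdfRange (absolutelyContinuous_expMeasure (δ := δ) hV) x
  refine ⟨cdf_nonneg _ _, ?_, fun h => (mul_pos hε (h5 h)).trans_le h1⟩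
  linarith [mul_pos hε (sub_pos.2 h4)]

/-- The Gaussian tail beyond S x is the ν-tail beyond x, hence at least ε times the Gaussian tail
beyond T x. A one-sided bound is enough, since the right boundary term enters with a plus sign and a
nonnegative factor. -/
theorem gaussMap_sub_le (hV : Measurable V) (hε : 0 < ε)
    (h : ∀ s, MeasurableSet s → ε * (expMeasure δ V).real s ≤ ν.real s) {x : ℝ}
    (hx : 0 ≤ transportMap δ V x) :
    gaussMap δ ν x - transportMap δ V x ≤ Real.sqrt (2 * Real.log ε⁻¹) := by
  have hγ := gaussMeasure_absolutelyContinuous δ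
  have hr := cdf_mem_cdfRange (absolutelyContinuous_expMeasure (δ := δ) hV) x
  have hr' := cdf_mem_cdfRange_of_le hV hε h x
  have h2 := (mul_cdf_le h x).2
  rw [transportMap_eq_gaussMap] at hx ⊢
  refine sub_le_of_gaussTail_le δ hx hε ?_
  rw [gaussMap, gaussMap, ← one_sub_cdf_gaussMeasure δ (quantile_mem hγ hr),
    ← one_sub_cdf_gaussMeasure δ (quantile_mem hγ hr'), cdf_quantile hγ hr, cdf_quantile hγ hr']
  exact h2

theorem sub_gaussMap_le {V : ℝ → ℝ} [hμ : IsProbabilityMeasure (expMeasure ⊥ V)]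
    (hV : Measurable V) (hε : 0 < ε)
    (h : ∀ s, MeasurableSet s → ε * (expMeasure ⊥ V).real s ≤ ν.real s) {x : ℝ}
    (hx : transportMap ⊥ V x ≤ 0) :
    transportMap ⊥ V x - gaussMap ⊥ ν x ≤ Real.sqrt (2 * Real.log ε⁻¹) := by
  have hγ := gaussMeasure_absolutelyContinuous ⊥
  have hr := cdf_mem_cdfRange (absolutelyContinuous_expMeasure (δ := ⊥) hV) x
  have hr' := cdf_mem_cdfRange_of_le hV hε h x
  have h2 := (mul_cdf_le h x).1
  rw [transportMap_eq_gaussMap] at hx ⊢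
  have h3 := sub_le_of_gaussTail_le ⊥ (neg_nonneg.2 hx) hε (s := -gaussMap ⊥ ν x) (by
    rw [← cdf_gaussMeasure_bot, ← cdf_gaussMeasure_bot, gaussMap, gaussMap, cdf_quantile hγ hr,
      cdf_quantile hγ hr']
    exact h2)
  linarith

/-- The boundary terms of the entropy bound on the exhausting intervals vanish in the limit. -/
theorem exists_boundary_bound (hV : Measurable V) (hε : 0 < ε)
    (hac : ν ≪ volume.restrict (halfLine δ))
    (h : ∀ s, MeasurableSet s → ε * (expMeasure δ V).real s ≤ ν.real s) {H : ℝ → ℝ} {M : ℝ}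
    (hH0 : ∀ x, 0 ≤ H x) (hHM : ∀ x, H x ≤ M) :
    ∃ β : ℕ → ℝ, Tendsto β atTop (𝓝 0) ∧ ∀ᶠ n in atTop,
      H (exhaustRight δ n) * gaussDensity δ (transportMap δ V (exhaustRight δ n)) *
          (gaussMap δ ν (exhaustRight δ n) - transportMap δ V (exhaustRight δ n)) -
        H (exhaustLeft δ n) * gaussDensity δ (transportMap δ V (exhaustLeft δ n)) *
          (gaussMap δ ν (exhaustLeft δ n) - transportMap δ V (exhaustLeft δ n)) ≤ β n := by
  set D := Real.sqrt (2 * Real.log ε⁻¹)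
  have hD : 0 ≤ D := Real.sqrt_nonneg _
  have key : ∀ x θ t : ℝ, θ ≤ D → H x * gaussDensity δ t * θ ≤ M * gaussDensity δ t * D := by
    intro x θ t hθ
    have hw := gaussDensity_pos δ t
    exact (mul_le_mul_of_nonneg_left hθ (mul_nonneg (hH0 x) hw.le)).trans
      (mul_le_mul_of_nonneg_right (mul_le_mul_of_nonneg_right (hHM x) hw.le) hD)
  have tR : Tendsto (fun n => transportMap δ V (exhaustRight δ n)) atTop atTop :=
    (tendsto_transportMap_atTop hV).comp (tendsto_exhaustRight δ)
  have bR : Tendsto (fun n => M * gaussDensity δ (transportMap δ V (exhaustRight δ n)) * D)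
      atTop (𝓝 0) := by
    simpa using (((tendsto_gaussDensity_atTop δ).comp tR).const_mul M).mul_const D
  have eR : ∀ᶠ n in atTop, H (exhaustRight δ n) *
      gaussDensity δ (transportMap δ V (exhaustRight δ n)) *
      (gaussMap δ ν (exhaustRight δ n) - transportMap δ V (exhaustRight δ n)) ≤
      M * gaussDensity δ (transportMap δ V (exhaustRight δ n)) * D := by
    filter_upwards [tR.eventually_ge_atTop 0] with n hn
    exact key _ _ _ (gaussMap_sub_le hV hε h hn)
  -- On the whole line the left end is treated like the right one, by reflection. For finite δ the
  -- left end is δ itself, where both distribution functions vanish and S = T.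
  rcases eq_or_ne δ ⊥ with rfl | hδ
  · have tL : Tendsto (fun n => -transportMap ⊥ V (exhaustLeft ⊥ n)) atTop atTop :=
      tendsto_neg_atBot_atTop.comp ((tendsto_transportMap_atBot hV).comp tendsto_exhaustLeft_bot)
    have bL : Tendsto (fun n => M * gaussDensity ⊥ (transportMap ⊥ V (exhaustLeft ⊥ n)) * D)
        atTop (𝓝 0) := by
      have := (((tendsto_gaussDensity_atTop ⊥).comp tL).const_mul M).mul_const D
      simpa [Function.comp_def, gaussDensity_neg] using this
    refine ⟨_, (bR.add bL).trans (by simp), ?_⟩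
    filter_upwards [eR, tL.eventually_ge_atTop 0] with n hn hL
    have := key (exhaustLeft ⊥ n) _ (transportMap ⊥ V (exhaustLeft ⊥ n))
      (sub_gaussMap_le hV hε h (neg_nonneg.1 hL))
    linarith
  · obtain ⟨d, rfl⟩ := WithBot.ne_bot_iff_exists.1 hδ
    refine ⟨_, bR, ?_⟩
    filter_upwards [eR] with n hn
    have hz : ∀ y < d, y ∉ halfLine (d : WithBot ℝ) := fun y hy => by simp [halfLine_coe, hy]
    have h1 : gaussMap d ν (exhaustLeft d n) = transportMap d V (exhaustLeft d n) := by
      rw [transportMap_eq_gaussMap, gaussMap, gaussMap, show exhaustLeft (d : WithBot ℝ) n = d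
        from rfl, cdf_eq_zero_of_notMem hac hz,
        cdf_eq_zero_of_notMem expMeasure_absolutelyContinuous hz]
    rw [h1, sub_self, mul_zero, sub_zero]
    exact hn

end LowerBound

/-! ### Bounded densities and Young's inequality. -/

section Young

theorem integrable_mul_log_of_bounded {μ : Measure ℝ} [IsFiniteMeasure μ] {h : ℝ → ℝ} {M : ℝ}
    (hh : Measurable h) (h0 : ∀ x, 0 ≤ h x) (hM : ∀ x, h x ≤ M) :
    Integrable (fun x => h x * Real.log (h x)) μ := by
  obtain ⟨C, hC⟩ := isCompact_Icc.exists_bound_of_continuousOn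
    (Real.continuous_mul_log.continuousOn (s := Icc 0 M))
  exact Integrable.of_bound (hh.mul hh.log).aestronglyMeasurable C
    (Eventually.of_forall fun x => hC _ ⟨h0 x, hM x⟩)

/-- Expand the square of λvpθ + wq. The slack p² ≤ H accommodates p = (1−ε)f with H = (1−ε)f² + ε,
and (w/v)² is the weight α. -/
theorem neg_mul_le_young {v lam p q w θ H : ℝ} (hv : 0 < v) (hl : 0 < lam) (hp : p ^ 2 ≤ H) :
    -(2 * p * q * (w * θ)) ≤ lam * (v * (H * θ ^ 2)) + v * ((w / v) ^ 2 * q ^ 2) / lam := by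
  have h1 : v * ((w / v) ^ 2 * q ^ 2) / lam = (w * q) ^ 2 / (lam * v) := by field_simp
  have h2 : lam * (v * (p ^ 2 * θ ^ 2)) ≤ lam * (v * (H * θ ^ 2)) := by gcongr
  have h3 : 0 ≤ (lam * v * (p * θ) + w * q) ^ 2 / (lam * v) := by positivity
  have h4 : (lam * v * (p * θ) + w * q) ^ 2 / (lam * v) =
      lam * (v * (p ^ 2 * θ ^ 2)) + 2 * p * q * (w * θ) + (w * q) ^ 2 / (lam * v) := by
    field_simp
    ring
  rw [h1]
  linarith

end Young

/-! ### The linearized HWI inequality for regularized densities. -/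

section HWI

variable {δ : WithBot ℝ} {V : ℝ → ℝ} [hμ : IsProbabilityMeasure (expMeasure δ V)]

theorem ae_derivWithin_eq_deriv {f : ℝ → ℝ} {a b : ℝ} (ha : a ∈ halfLine δ) :
    ∀ᵐ x, x ∈ Icc a b → derivWithin f (halfLine δ) x = deriv f x := by
  have h1 : ∀ᵐ x : ℝ, x ≠ a := by simp [ae_iff, measure_singleton]
  filter_upwards [h1] with x hx hxI
  exact derivWithin_of_mem_nhds (halfLine_mem_nhds ha (lt_of_le_of_ne hxI.1 (Ne.symm hx)))

/-- The weight and `derivWithin` are replaced by measurable expressions equal to them almost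
everywhere, which turns finite energy into Bochner integrability. -/
theorem integrableOn_weight_mul_deriv_sq (hV : Measurable V) {f : ℝ → ℝ} {a b : ℝ}
    (ha : a ∈ halfLine δ) (hab : a ≤ b) (hE : weightedEnergy δ V f ≠ ⊤) :
    IntegrableOn (fun x => (gaussDensity δ (transportMap δ V x) / Real.exp (V x)) ^ 2 *
        deriv f x ^ 2) (Icc a b) (expMeasure δ V) ∧
      ∫ x in Icc a b, (gaussDensity δ (transportMap δ V x) / Real.exp (V x)) ^ 2 *
        deriv f x ^ 2 ∂(expMeasure δ V) ≤ (weightedEnergy δ V f).toReal := by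
  set F : ℝ → ℝ := fun x => (gaussDensity δ (transportMap δ V x) / Real.exp (V x)) ^ 2 *
    deriv f x ^ 2
  have hF0 : ∀ x, 0 ≤ F x := fun x => mul_nonneg (sq_nonneg _) (sq_nonneg _)
  have hFm : Measurable F :=
    ((((continuous_gaussDensity δ).measurable.comp (monotone_transportMap hV).measurable).div
      hV.exp).pow_const 2).mul ((measurable_deriv f).pow_const 2)
  have hle : ∫⁻ x in Icc a b, ENNReal.ofReal (F x) ∂(expMeasure δ V) ≤ weightedEnergy δ V f := by
    refine le_trans (le_of_eq ?_) (setLIntegral_le_lintegral (Icc a b) _)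
    refine lintegral_congr_ae ?_
    have hac : (expMeasure δ V).restrict (Icc a b) ≪ volume :=
      Measure.restrict_le_self.absolutelyContinuous.trans
        (expMeasure_absolutelyContinuous.trans Measure.restrict_le_self.absolutelyContinuous)
    filter_upwards [hac.ae_le (ae_weight_eq (δ := δ) hV ha hab),
      hac.ae_le (ae_derivWithin_eq_deriv (δ := δ) (f := f) (b := b) ha),
      ae_restrict_mem measurableSet_Icc] with x h1 h2 hx
    rw [h1 hx, h2 hx]
  have hint : IntegrableOn F (Icc a b) (expMeasure δ V) := by
    refine ⟨hFm.aestronglyMeasurable, ?_⟩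
    rw [hasFiniteIntegral_iff_ofReal (Eventually.of_forall hF0)]
    exact hle.trans_lt (lt_top_iff_ne_top.2 hE)
  refine ⟨hint, ?_⟩
  rw [integral_eq_lintegral_of_nonneg_ae (Eventually.of_forall hF0) hFm.aestronglyMeasurable]
  exact ENNReal.toReal_mono hE hle

/-- The HWI inequality, linearized by Young's inequality, for the density `(1 - ε) f² + ε`. -/
theorem entropy_add_wasserstein_le (hV : Measurable V) {f H : ℝ → ℝ} {ε M Q lam : ℝ}
    (hf : ContDiffOn ℝ ∞ f (halfLine δ)) (hHm : Measurable H)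
    (hH : ∀ x ∈ halfLine δ, H x = (1 - ε) * f x ^ 2 + ε) (hε : 0 < ε) (hε1 : ε < 1)
    (hHε : ∀ x, ε ≤ H x) (hHM : ∀ x, H x ≤ M)
    [hν : IsProbabilityMeasure ((expMeasure δ V).withDensity fun x => ENNReal.ofReal (H x))]
    (hE : weightedEnergy δ V f ≠ ⊤) (hlam : 0 < lam)
    (hQ : wasserstein2 (transportDist δ V) (expMeasure δ V)
      ((expMeasure δ V).withDensity fun x => ENNReal.ofReal (H x)) ^ 2 ≤ ENNReal.ofReal Q)
    (hQ0 : 0 ≤ Q) :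
    (∫ x, H x * Real.log (H x) ∂(expMeasure δ V)) ≤
        lam * Q + (weightedEnergy δ V f).toReal / lam ∧
      wasserstein2 (transportDist δ V) (expMeasure δ V)
        ((expMeasure δ V).withDensity fun x => ENNReal.ofReal (H x)) ^ 2 ≤
        ENNReal.ofReal (2 * (lam * Q + (weightedEnergy δ V f).toReal / lam -
          ∫ x, H x * Real.log (H x) ∂(expMeasure δ V))) := by
  set μ := expMeasure δ V
  set ν := μ.withDensity fun x => ENNReal.ofReal (H x) with hνdef
  set S := gaussMap δ ν
  set T := transportMap δ V
  set E := (weightedEnergy δ V f).toReal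
  have hac : ν ≪ volume.restrict (halfLine δ) := withDensity_absolutelyContinuous_halfLine _
  have hμac : μ ≪ volume.restrict (halfLine δ) := expMeasure_absolutelyContinuous
  have hH0 : ∀ x, 0 ≤ H x := fun x => hε.le.trans (hHε x)
  have hlow : ∀ s, MeasurableSet s → ε * μ.real s ≤ ν.real s := by
    intro s hs
    rw [measureReal_def, measureReal_def, ← ENNReal.toReal_ofReal hε.le, ← ENNReal.toReal_mul]
    refine ENNReal.toReal_mono (measure_ne_top _ _) ?_
    rw [hνdef, withDensity_apply _ hs, ← setLIntegral_const]
    exact lintegral_mono fun x => ENNReal.ofReal_le_ofReal (hHε x)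
  have hr := cdf_mem_cdfRange_of_le hV hε hlow
  have hentint : Integrable (fun x => H x * Real.log (H x)) μ :=
    integrable_mul_log_of_bounded hHm hH0 hHM
  obtain ⟨β, hβ, hbdry⟩ := exists_boundary_bound hV hε hac hlow hH0 hHM
  have hWI : wasserstein2 (transportDist δ V) μ ν ^ 2 =
      ∫⁻ x, ENNReal.ofReal (H x * (S x - T x) ^ 2) ∂μ := by
    rw [wasserstein2_sq_eq hV hac]
    conv_lhs => rw [hνdef]
    rw [lintegral_withDensity_eq_lintegral_mul_non_measurable _ hHm.ennreal_ofReal (by simp)]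
    refine lintegral_congr fun x => ?_
    rw [Pi.mul_apply, ENNReal.ofReal_mul (hH0 x)]
  have hSm : AEMeasurable (fun x => ENNReal.ofReal (H x * (S x - T x) ^ 2)) μ := by
    have h1 : Measurable S := Monotone.measurable fun x y hxy =>
      (strictMonoOn_quantile (gaussMeasure_absolutelyContinuous δ)
        (absolutelyContinuous_gaussMeasure δ)).monotoneOn (hr x) (hr y) ((cdf ν).mono hxy)
    exact (hHm.mul ((h1.sub
      (monotone_transportMap hV).measurable).pow_const 2)).ennreal_ofReal.aemeasurable
  -- D is the transport cost carried by the n-th interval; the estimate combines the entropy bound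
  -- there with Young's inequality for the term in H'.
  have hloc : ∀ n, ∃ D : ℝ, 0 ≤ D ∧
      ∫⁻ x in exhaustion δ n, ENNReal.ofReal (H x * (S x - T x) ^ 2) ∂μ = ENNReal.ofReal D ∧
      (∫ x in exhaustion δ n, H x * Real.log (H x) ∂μ) + D / 2 ≤
        H (exhaustRight δ n) * gaussDensity δ (T (exhaustRight δ n)) *
          (S (exhaustRight δ n) - T (exhaustRight δ n)) -
        H (exhaustLeft δ n) * gaussDensity δ (T (exhaustLeft δ n)) *
          (S (exhaustLeft δ n) - T (exhaustLeft δ n)) + (lam * D + E / lam) := by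
    intro n
    rw [exhaustion]
    have ha := exhaustLeft_mem δ n
    have hab := exhaustLeft_le_exhaustRight δ n
    set a := exhaustLeft δ n
    set b := exhaustRight δ n
    obtain ⟨hTac, hT'⟩ := transportMap_ae hV ha hab
    obtain ⟨hSac, hS'⟩ := gaussMap_ae hV hHm hH0 ha hab (hr a) (hr b)
    have hv := intervalIntegrable_exp hV ha hab
    have hfac : AbsolutelyContinuousOnInterval f a b := by
      refine ContDiffOn.absolutelyContinuousOnInterval ((hf.of_le (by simp)).mono ?_)
      rw [uIcc_of_le hab]
      exact Icc_subset_halfLine ha b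
    have hHac : AbsolutelyContinuousOnInterval H a b := by
      have hsq := (hfac.fun_mul hfac)
      refine hsq.of_dist_le (K := 1 - ε) ?_
      rw [uIcc_of_le hab]
      intro x hx y hy
      rw [hH x (Icc_subset_halfLine ha b hx), hH y (Icc_subset_halfLine ha b hy),
        dist_add_right, ← sq, ← sq, Real.dist_eq, Real.dist_eq, ← mul_sub, abs_mul,
        abs_of_pos (sub_pos.2 hε1)]
    have hHcont := hHac.continuousOn
    have hcore := integral_entropy_le hab hSac hTac hHac hH0 (fun x => Real.exp_pos (V x)) hv
      hS' hT'
    obtain ⟨hFint, hFle⟩ := integrableOn_weight_mul_deriv_sq (δ := δ) hV ha hab hE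
    rw [setIntegral_expMeasure hV ha hab] at hFle
    rw [integrableOn_expMeasure_iff hV ha hab] at hFint
    have hθc : ContinuousOn (fun x => H x * (S x - T x) ^ 2) (uIcc a b) :=
      hHcont.mul ((hSac.continuousOn.sub hTac.continuousOn).pow 2)
    have hDint : IntervalIntegrable (fun x => Real.exp (V x) * (H x * (S x - T x) ^ 2))
        volume a b := hv.mul_continuousOn hθc
    have hdint : IntervalIntegrable (fun x => deriv H x * (gaussDensity δ (T x) * (S x - T x)))
        volume a b := hHac.intervalIntegrable_deriv.mul_continuousOn
      (hTac.gaussDensity_comp.continuousOn.mul (hSac.continuousOn.sub hTac.continuousOn))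
    have hyoung : -∫ x in a..b, deriv H x * (gaussDensity δ (T x) * (S x - T x)) ≤
        lam * (∫ x in a..b, Real.exp (V x) * (H x * (S x - T x) ^ 2)) +
        (∫ x in a..b, Real.exp (V x) * ((gaussDensity δ (T x) / Real.exp (V x)) ^ 2 *
          deriv f x ^ 2)) / lam := by
      rw [← intervalIntegral.integral_neg, ← intervalIntegral.integral_const_mul,
        ← intervalIntegral.integral_div,
        ← intervalIntegral.integral_add (hDint.const_mul _) (hFint.div_const _)]
      refine intervalIntegral.integral_mono_ae_restrict hab hdint.neg
        ((hDint.const_mul _).add (hFint.div_const _)) ?_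
      have hne : ∀ᵐ x : ℝ, x ≠ a := by simp [ae_iff, measure_singleton]
      filter_upwards [ae_restrict_mem measurableSet_Icc, ae_restrict_of_ae hne] with x hx hxa
      have hnhds := halfLine_mem_nhds ha (lt_of_le_of_ne hx.1 (Ne.symm hxa))
      have hxJ := Icc_subset_halfLine ha b hx
      have hfd : HasDerivAt f (deriv f x) x :=
        ((hf.differentiableOn (by simp)).differentiableAt hnhds).hasDerivAt
      have hHd : deriv H x = 2 * ((1 - ε) * f x) * deriv f x := by
        refine HasDerivAt.deriv ?_
        have h1 := ((hfd.pow 2).const_mul (1 - ε)).add_const ε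
        refine (h1.congr_of_eventuallyEq ?_).congr_deriv (by ring)
        filter_upwards [hnhds] with y hy using hH y hy
      rw [hHd]
      refine neg_mul_le_young (Real.exp_pos _) hlam ?_
      rw [hH x hxJ]
      nlinarith [mul_nonneg (mul_nonneg hε.le (sub_pos.2 hε1).le) (sq_nonneg (f x))]
    refine ⟨∫ x in a..b, Real.exp (V x) * (H x * (S x - T x) ^ 2), ?_, ?_, ?_⟩
    · exact intervalIntegral.integral_nonneg hab fun x _ =>
        mul_nonneg (Real.exp_pos _).le (mul_nonneg (hH0 x) (sq_nonneg _))
    · rw [← setIntegral_expMeasure hV ha hab, ofReal_integral_eq_lintegral_ofReal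
        ((integrableOn_expMeasure_iff hV ha hab _).2 hDint)
        (Eventually.of_forall fun x => mul_nonneg (hH0 x) (sq_nonneg _))]
    · rw [setIntegral_expMeasure hV ha hab]
      have := div_le_div_of_nonneg_right hFle hlam.le
      linarith
  choose D hD0 hDeq hDle using hloc
  have hDQ : ∀ n, D n ≤ Q := fun n => by
    rw [← ENNReal.ofReal_le_ofReal_iff hQ0, ← hDeq]
    exact (setLIntegral_le_lintegral _ _).trans (hWI ▸ hQ)
  have hup : Tendsto (fun n => 2 * (β n + (lam * Q + E / lam) -
      ∫ x in exhaustion δ n, H x * Real.log (H x) ∂μ)) atTop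
      (𝓝 (2 * (lam * Q + E / lam - ∫ x, H x * Real.log (H x) ∂μ))) := by
    have := (aecover_exhaustion δ hμac).integral_tendsto_of_countably_generated hentint
    simpa using ((hβ.add_const (lam * Q + E / lam)).sub this).const_mul 2
  have hDup : ∀ᶠ n in atTop, D n ≤ 2 * (β n + (lam * Q + E / lam) -
      ∫ x in exhaustion δ n, H x * Real.log (H x) ∂μ) := by
    filter_upwards [hbdry] with n hn
    have h1 := hDle n
    have h2 := mul_le_mul_of_nonneg_left (hDQ n) hlam.le
    linarith
  constructor
  -- Discarding D ≥ 0 leaves a bound on the entropy alone, which says that the argument of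
  -- `ENNReal.ofReal` in the second claim is nonnegative.
  · have := ge_of_tendsto hup (hDup.mono fun n hn => (hD0 n).trans hn)
    linarith
  · rw [hWI]
    have hlim := (aecover_exhaustion δ hμac).lintegral_tendsto_of_countably_generated hSm
    refine le_of_tendsto_of_tendsto hlim (ENNReal.tendsto_ofReal hup) ?_
    filter_upwards [hDup] with n hn
    rw [hDeq]
    exact ENNReal.ofReal_le_ofReal hn

end HWI

/-! ### Removing the regularization, and the inequalities for test functions. -/

section TestFunction

variable {δ : WithBot ℝ} {V f : ℝ → ℝ}

/-- Off the half-line f is arbitrary, so f is replaced by its indicator version, which is bounded,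
measurable and μ-almost everywhere equal to f. -/
theorem IsTestFunction.exists_bound (hf : IsTestFunction δ f) :
    ∃ C, ∀ x, |(halfLine δ).indicator f x| ≤ C := by
  obtain ⟨hs, K, hK, h0⟩ := hf
  obtain ⟨C, hC⟩ := (hK.inter_right (isClosed_halfLine δ)).exists_bound_of_continuousOn
    (hs.continuousOn.mono inter_subset_right)
  refine ⟨max C 0, fun x => ?_⟩
  by_cases hx : x ∈ halfLine δ
  · rw [indicator_of_mem hx]
    by_cases hxK : x ∈ K
    · exact (hC x ⟨hxK, hx⟩).trans (le_max_left _ _)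
    · simp [h0 x hx hxK]
  · simp [hx]

theorem IsTestFunction.measurable_indicator (hf : IsTestFunction δ f) :
    Measurable ((halfLine δ).indicator f) := by
  classical
  rw [← piecewise_eq_indicator]
  exact hf.1.continuousOn.measurable_piecewise continuousOn_const (measurableSet_halfLine δ)

theorem ae_eq_indicator_halfLine (f : ℝ → ℝ) :
    f =ᵐ[expMeasure δ V] (halfLine δ).indicator f := by
  filter_upwards [ae_mem_halfLine (expMeasure_absolutelyContinuous (δ := δ) (V := V))] with x hx
  rw [indicator_of_mem hx]

variable [hμ : IsProbabilityMeasure (expMeasure δ V)]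

theorem IsTestFunction.sqEntropy_eq (hf : IsTestFunction δ f) :
    ∃ e : ℝ, sqEntropy (expMeasure δ V) f = e ∧
      ∫ x, (halfLine δ).indicator f x ^ 2 * Real.log ((halfLine δ).indicator f x ^ 2)
        ∂(expMeasure δ V) = e := by
  obtain ⟨C, hC⟩ := hf.exists_bound
  refine ⟨_, ?_, rfl⟩
  rw [sqEntropy_congr (ae_eq_indicator_halfLine f), sqEntropy_of_integrable]
  exact integrable_mul_log_of_bounded (hf.measurable_indicator.pow_const 2)
    (fun x => sq_nonneg _) (M := C ^ 2) fun x => by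
      rw [← sq_abs]; exact pow_le_pow_left₀ (abs_nonneg _) (hC x) 2

/-- A bounded density has finite entropy, so Talagrand's inequality applies with a finite right
side. -/
theorem IsTestFunction.wasserstein2_ne_top (hV : Measurable V) (hf : IsTestFunction δ f)
    (h1 : ∫ x, f x ^ 2 ∂(expMeasure δ V) = 1) :
    wasserstein2 (transportDist δ V) (expMeasure δ V) (sqDensity (expMeasure δ V) f) ≠ ⊤ := by
  intro htop
  obtain ⟨e, he, -⟩ := hf.sqEntropy_eq (V := V)
  have h := talagrand_inequality hV
    ((hf.measurable_indicator.aemeasurable).congr (ae_eq_indicator_halfLine f).symm) h1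
  rw [htop, he, ENNReal.top_pow two_ne_zero, EReal.coe_ennreal_top, top_le_iff] at h
  exact EReal.coe_ne_top (2 * e) (by rw [← h, EReal.coe_mul]; rfl)

/-- f vanishes far to the right, where μ has mass, so f²μ ≠ μ. This permits division by W and
excludes the product ∞ · 0 in the HWI inequality. -/
theorem IsTestFunction.wasserstein2_ne_zero (hV : Measurable V) (hf : IsTestFunction δ f)
    (h1 : ∫ x, f x ^ 2 ∂(expMeasure δ V) = 1) :
    wasserstein2 (transportDist δ V) (expMeasure δ V) (sqDensity (expMeasure δ V) f) ≠ 0 := by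
  intro hW
  obtain ⟨-, hprob⟩ := isProbabilityMeasure_sqDensity h1
  have heq := eq_of_wasserstein2_eq_zero hV
    (ν := sqDensity (expMeasure δ V) f) (withDensity_absolutelyContinuous_halfLine _) hW
  obtain ⟨-, K, hK, h0⟩ := hf
  obtain ⟨R, hR⟩ := hK.bddAbove
  obtain ⟨c, hc⟩ := exists_mem_halfLine δ
  have hm : max c R ∈ halfLine δ := halfLine_mono hc (le_max_left _ _)
  have hpos : 0 < expMeasure δ V (Ioi (max c R)) :=
    measure_pos_of_Ioo_subset (absolutelyContinuous_expMeasure hV) hm (lt_add_one _)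
      Ioo_subset_Ioi_self
  rw [heq, sqDensity, withDensity_apply _ measurableSet_Ioi,
    setLIntegral_congr_fun measurableSet_Ioi (g := fun _ => 0) fun x hx => ?_] at hpos
  · simp at hpos
  · have hxK : x ∉ K := fun hxK => absurd ((hR hxK).trans (le_max_right c R)) (not_le.2 hx)
    simp [h0 x (halfLine_mono hm (le_of_lt hx)) hxK]

theorem ENNReal.convex_combination_between {p q A B : ℝ≥0∞} (hpq : p + q = 1) :
    min A B ≤ p * B + q * A ∧ p * B + q * A ≤ max A B := by
  constructor
  · calc min A B = p * min A B + q * min A B := by rw [← add_mul, hpq, one_mul]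
      _ ≤ _ := by gcongr; exacts [min_le_right _ _, min_le_left _ _]
  · calc p * B + q * A ≤ p * max A B + q * max A B := by
          gcongr; exacts [le_max_right _ _, le_max_left _ _]
      _ = _ := by rw [← add_mul, hpq, one_mul]

/-- The HWI inequality, linearized by Young's inequality. -/
theorem IsTestFunction.linearized_hwi (hV : Measurable V) (hf : IsTestFunction δ f)
    (h1 : ∫ x, f x ^ 2 ∂(expMeasure δ V) = 1) (hE : weightedEnergy δ V f ≠ ⊤) {e lam : ℝ}
    (he : sqEntropy (expMeasure δ V) f = e) (hlam : 0 < lam) :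
    e + (wasserstein2 (transportDist δ V) (expMeasure δ V)
        (sqDensity (expMeasure δ V) f)).toReal ^ 2 / 2 ≤
      lam * (wasserstein2 (transportDist δ V) (expMeasure δ V)
        (sqDensity (expMeasure δ V) f)).toReal ^ 2 + (weightedEnergy δ V f).toReal / lam := by
  have hWtop := hf.wasserstein2_ne_top hV h1
  obtain ⟨e', he', hint⟩ := hf.sqEntropy_eq (V := V)
  obtain rfl : e' = e := by rw [he] at he'; exact_mod_cast he'.symm
  obtain ⟨C, hC⟩ := hf.exists_bound
  have hgm := hf.measurable_indicator
  have hgJ : ∀ x ∈ halfLine δ, (halfLine δ).indicator f x = f x := fun x hx =>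
    indicator_of_mem hx f
  have h1' : ∫ x, (halfLine δ).indicator f x ^ 2 ∂(expMeasure δ V) = 1 := by
    rw [← h1]
    refine integral_congr_ae ?_
    filter_upwards [ae_eq_indicator_halfLine (δ := δ) (V := V) f] with x hx
    rw [← hx]
  rw [sqDensity_congr (ae_eq_indicator_halfLine f)] at hWtop ⊢
  generalize (halfLine δ).indicator f = g at *
  set μ := expMeasure δ V
  set ν := sqDensity μ g with hνdef
  obtain ⟨hg2, hprob⟩ := isProbabilityMeasure_sqDensity h1'
  set W := wasserstein2 (transportDist δ V) μ ν
  set E := (weightedEnergy δ V f).toReal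
  have hgC : ∀ x, g x ^ 2 ≤ C ^ 2 := fun x => by
    rw [← sq_abs]; exact pow_le_pow_left₀ (abs_nonneg _) (hC x) 2
  -- The shift by 2 keeps ε n strictly below 1, also at n = 0.
  set ε : ℕ → ℝ := fun n => 1 / ((n : ℝ) + 2)
  have hε0 : ∀ n, 0 < ε n := fun n => by positivity
  have hε1 : ∀ n, ε n < 1 := fun n => by
    rw [div_lt_one (by positivity)]; linarith [n.cast_nonneg (α := ℝ)]
  have hεlim : Tendsto ε atTop (𝓝 0) :=
    tendsto_const_nhds.div_atTop (tendsto_atTop_add_const_right _ _ tendsto_natCast_atTop_atTop)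
  set H : ℕ → ℝ → ℝ := fun n x => (1 - ε n) * g x ^ 2 + ε n
  have hHm : ∀ n, Measurable (H n) := fun n => ((hgm.pow_const 2).const_mul _).add_const _
  have hHε : ∀ n x, ε n ≤ H n x := fun n x =>
    le_add_of_nonneg_left (mul_nonneg (sub_pos.2 (hε1 n)).le (sq_nonneg _))
  have hHM : ∀ n x, H n x ≤ C ^ 2 + 1 := fun n x => by
    have h2 : (1 - ε n) * g x ^ 2 ≤ 1 * g x ^ 2 :=
      mul_le_mul_of_nonneg_right (by linarith [hε0 n]) (sq_nonneg _)
    have := hε1 n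
    have := hgC x
    simp only [H]
    linarith
  set N : ℕ → Measure ℝ := fun n => μ.withDensity fun x => ENNReal.ofReal (H n x)
  have hN : ∀ n {s : Set ℝ}, MeasurableSet s →
      N n s = ENNReal.ofReal (1 - ε n) * ν s + ENNReal.ofReal (ε n) * μ s := by
    intro n s hs
    have h2 : ∀ x, ENNReal.ofReal (H n x) =
        ENNReal.ofReal (1 - ε n) * ENNReal.ofReal (g x ^ 2) + ENNReal.ofReal (ε n) := fun x => by
      rw [← ENNReal.ofReal_mul (sub_pos.2 (hε1 n)).le, ← ENNReal.ofReal_add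
        (mul_nonneg (sub_pos.2 (hε1 n)).le (sq_nonneg _)) (hε0 n).le]
    rw [show N n s = ∫⁻ x in s, ENNReal.ofReal (H n x) ∂μ from withDensity_apply _ hs,
      lintegral_congr h2, lintegral_add_right _ measurable_const, setLIntegral_const,
      lintegral_const_mul _ (hgm.pow_const 2).ennreal_ofReal, hνdef, sqDensity,
      withDensity_apply _ hs]
  have hpq : ∀ n, ENNReal.ofReal (1 - ε n) + ENNReal.ofReal (ε n) = 1 := fun n => by
    rw [← ENNReal.ofReal_add (sub_pos.2 (hε1 n)).le (hε0 n).le]; simp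
  have hNprob : ∀ n, IsProbabilityMeasure (N n) := fun n => ⟨by
    rw [hN n MeasurableSet.univ, measure_univ, measure_univ, mul_one, mul_one, hpq]⟩
  have hNac : ∀ n, N n ≪ volume.restrict (halfLine δ) := fun n =>
    withDensity_absolutelyContinuous_halfLine _
  have hνac : ν ≪ volume.restrict (halfLine δ) := withDensity_absolutelyContinuous_halfLine _
  have hTm := (monotone_transportMap (δ := δ) hV).measurable
  have hset : ∀ t, MeasurableSet {x | transportMap δ V x ≤ t} := fun t =>
    measurableSet_le hTm measurable_const
  have hmono : ∀ ρ : Measure ℝ, Monotone fun t => ρ {x | transportMap δ V x ≤ t} :=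
    fun ρ s t hst => measure_mono fun x hx => le_trans hx hst
  have hWr : W ^ 2 = ENNReal.ofReal (W.toReal ^ 2) := by
    rw [ENNReal.ofReal_pow ENNReal.toReal_nonneg, ENNReal.ofReal_toReal hWtop]
  have hstep : ∀ n, (∫ x, H n x * Real.log (H n x) ∂μ) ≤ lam * W.toReal ^ 2 + E / lam ∧
      wasserstein2 (transportDist δ V) μ (N n) ^ 2 ≤
        ENNReal.ofReal (2 * (lam * W.toReal ^ 2 + E / lam -
          ∫ x, H n x * Real.log (H n x) ∂μ)) := by
    intro n
    refine entropy_add_wasserstein_le (hν := hNprob n) hV hf.1 (hHm n)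
      (fun x hx => by simp only [H]; rw [hgJ x hx]) (hε0 n) (hε1 n) (hHε n) (hHM n) hE hlam ?_
      (sq_nonneg _)
    -- The a priori bound Q is W(μ, ν)² itself: the distribution function of the mixture lies
    -- between those of μ and ν.
    rw [← hWr, wasserstein2_sq_eq_crossingCost hV (hNac n),
      wasserstein2_sq_eq_crossingCost hV hνac]
    refine crossingCost_le_of_between (hmono μ) (fun t => ?_) fun t => ?_
    · exact (ENNReal.convex_combination_between (hpq n)).1.trans_eq (hN n (hset t)).symm
    · exact (hN n (hset t)).trans_le (ENNReal.convex_combination_between (hpq n)).2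
  have hent : Tendsto (fun n => ∫ x, H n x * Real.log (H n x) ∂μ) atTop (𝓝 e') := by
    rw [← hint]
    obtain ⟨B, hB⟩ := isCompact_Icc.exists_bound_of_continuousOn
      (Real.continuous_mul_log.continuousOn (s := Icc 0 (C ^ 2 + 1)))
    refine tendsto_integral_of_dominated_convergence (fun _ => B)
      (fun n => ((hHm n).mul (hHm n).log).aestronglyMeasurable) (integrable_const B)
      (fun n => Eventually.of_forall fun x => hB _ ⟨(hε0 n).le.trans (hHε n x), hHM n x⟩)
      (Eventually.of_forall fun x => ?_)
    have h2 : Tendsto (fun n => H n x) atTop (𝓝 (g x ^ 2)) := by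
      simpa using ((hεlim.const_sub 1).mul_const (g x ^ 2)).add hεlim
    exact (Real.continuous_mul_log.tendsto _).comp h2
  have hle : e' ≤ lam * W.toReal ^ 2 + E / lam := le_of_tendsto' hent fun n => (hstep n).1
  have hlsc : W ^ 2 ≤ ENNReal.ofReal (2 * (lam * W.toReal ^ 2 + E / lam - e')) := by
    rw [wasserstein2_sq_eq_crossingCost hV hνac]
    have hlim : ∀ t, Tendsto (fun n => N n {x | transportMap δ V x ≤ t}) atTop
        (𝓝 (ν {x | transportMap δ V x ≤ t})) := fun t => by
      simp_rw [hN _ (hset t)]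
      have t1 : Tendsto (fun n => ENNReal.ofReal (1 - ε n)) atTop (𝓝 1) := by
        simpa using ENNReal.tendsto_ofReal (hεlim.const_sub 1)
      have t2 : Tendsto (fun n => ENNReal.ofReal (ε n)) atTop (𝓝 0) := by
        simpa using ENNReal.tendsto_ofReal hεlim
      simpa using (ENNReal.Tendsto.mul_const t1 (Or.inr (measure_ne_top ν _))).add
        (ENNReal.Tendsto.mul_const t2 (Or.inr (measure_ne_top μ _)))
    refine (crossingCost_le_liminf (hmono μ) (fun s => measure_ne_top _ _)
      (fun n => hmono (N n)) hlim).trans ?_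
    have hR : Tendsto (fun n => ENNReal.ofReal (2 * (lam * W.toReal ^ 2 + E / lam -
        ∫ x, H n x * Real.log (H n x) ∂μ))) atTop
        (𝓝 (ENNReal.ofReal (2 * (lam * W.toReal ^ 2 + E / lam - e')))) :=
      ENNReal.tendsto_ofReal ((hent.const_sub _).const_mul 2)
    rw [← hR.liminf_eq]
    refine liminf_le_liminf (Eventually.of_forall fun n => ?_)
    rw [← wasserstein2_sq_eq_crossingCost hV (hNac n)]
    exact (hstep n).2
  -- The entropy bound `hle` makes the right side nonnegative, so the comparison can be read in the
  -- reals.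
  rw [hWr, ENNReal.ofReal_le_ofReal_iff (by linarith)] at hlsc
  linarith

theorem IsTestFunction.real_hwi (hV : Measurable V) (hf : IsTestFunction δ f)
    (h1 : ∫ x, f x ^ 2 ∂(expMeasure δ V) = 1) (hE : weightedEnergy δ V f ≠ ⊤) {e : ℝ}
    (he : sqEntropy (expMeasure δ V) f = e) :
    e + (wasserstein2 (transportDist δ V) (expMeasure δ V)
        (sqDensity (expMeasure δ V) f)).toReal ^ 2 / 2 ≤
      2 * Real.sqrt (weightedEnergy δ V f).toReal * (wasserstein2 (transportDist δ V)
        (expMeasure δ V) (sqDensity (expMeasure δ V) f)).toReal := by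
  have key := fun lam => hf.linearized_hwi hV h1 hE he (lam := lam)
  have hw := ENNReal.toReal_pos (hf.wasserstein2_ne_zero hV h1) (hf.wasserstein2_ne_top hV h1)
  have hE0 : 0 ≤ (weightedEnergy δ V f).toReal := ENNReal.toReal_nonneg
  generalize (wasserstein2 (transportDist δ V) (expMeasure δ V)
    (sqDensity (expMeasure δ V) f)).toReal = w at *
  generalize (weightedEnergy δ V f).toReal = E at *
  rcases hE0.eq_or_lt with rfl | hE0
  · rw [Real.sqrt_zero, mul_zero, zero_mul]
    refine le_of_forall_pos_le_add fun η hη => ?_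
    -- When the energy is 0 there is no optimal λ; this choice makes λw² = η arbitrarily small.
    have := key (η / w ^ 2) (by positivity)
    rw [div_mul_cancel₀ _ (by positivity)] at this
    simpa using this
  · have hs := Real.sqrt_pos.2 hE0
    -- The minimizer of λ ↦ λw² + E/λ.
    have := key (Real.sqrt E / w) (by positivity)
    have h2 : Real.sqrt E / w * w ^ 2 + E / (Real.sqrt E / w) = 2 * Real.sqrt E * w := by
      nth_rewrite 2 [← Real.mul_self_sqrt hE0.le]
      field_simp
      ring
    linarith

theorem hwi_inequality (hV : Measurable V) (hf : IsTestFunction δ f)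
    (h1 : ∫ x, f x ^ 2 ∂(expMeasure δ V) = 1) :
    sqEntropy (expMeasure δ V) f +
        ((wasserstein2 (transportDist δ V) (expMeasure δ V)
          (sqDensity (expMeasure δ V) f) ^ 2 / 2 : ℝ≥0∞) : EReal) ≤
      ((2 * weightedEnergy δ V f ^ (1 / 2 : ℝ) *
        wasserstein2 (transportDist δ V) (expMeasure δ V)
          (sqDensity (expMeasure δ V) f) : ℝ≥0∞) : EReal) := by
  have hW0 := hf.wasserstein2_ne_zero hV h1
  have hWt := hf.wasserstein2_ne_top hV h1
  obtain ⟨e, he, -⟩ := hf.sqEntropy_eq (V := V)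
  by_cases hE : weightedEnergy δ V f = ⊤
  · rw [hE, ENNReal.top_rpow_of_pos (by norm_num), ENNReal.mul_top two_ne_zero,
      ENNReal.top_mul hW0, EReal.coe_ennreal_top]
    exact le_top
  have h := hf.real_hwi hV h1 hE he
  rw [he]
  generalize wasserstein2 (transportDist δ V) (expMeasure δ V)
    (sqDensity (expMeasure δ V) f) = W at *
  generalize weightedEnergy δ V f = E at *
  rw [← EReal.coe_ennreal_toReal (ENNReal.div_ne_top (ENNReal.pow_ne_top hWt) two_ne_zero),
    ← EReal.coe_ennreal_toReal (ENNReal.mul_ne_top (ENNReal.mul_ne_top ENNReal.ofNat_ne_top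
      (ENNReal.rpow_ne_top_of_nonneg (by norm_num) hE)) hWt), ← EReal.coe_add,
    EReal.coe_le_coe_iff]
  simpa [ENNReal.toReal_mul, ← ENNReal.toReal_rpow, Real.sqrt_eq_rpow] using h

/-- HWI together with 2√E w ≤ 2E + w²/2, that is, (2√E − w)² ≥ 0. -/
theorem weighted_logSobolev_inequality (hV : Measurable V) (hf : IsTestFunction δ f)
    (h1 : ∫ x, f x ^ 2 ∂(expMeasure δ V) = 1) :
    sqEntropy (expMeasure δ V) f ≤ ((2 * weightedEnergy δ V f : ℝ≥0∞) : EReal) := by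
  obtain ⟨e, he, -⟩ := hf.sqEntropy_eq (V := V)
  by_cases hE : weightedEnergy δ V f = ⊤
  · rw [hE, ENNReal.mul_top two_ne_zero, EReal.coe_ennreal_top]
    exact le_top
  have h := hf.real_hwi hV h1 hE he
  rw [he, ← EReal.coe_ennreal_toReal (ENNReal.mul_ne_top ENNReal.ofNat_ne_top hE),
    EReal.coe_le_coe_iff, ENNReal.toReal_mul, ENNReal.toReal_ofNat]
  have hs := Real.mul_self_sqrt (ENNReal.toReal_nonneg (a := weightedEnergy δ V f))
  nlinarith [sq_nonneg (2 * Real.sqrt (weightedEnergy δ V f).toReal -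
    (wasserstein2 (transportDist δ V) (expMeasure δ V)
      (sqDensity (expMeasure δ V) f)).toReal)]

end TestFunction

end

theorem theorem4p1p1 (δ : WithBot ℝ) (V : ℝ → ℝ) (hV : Measurable V)
    (hμ : IsProbabilityMeasure (expMeasure δ V)) :
    -- the weighted log-Sobolev inequality
    (∀ f : ℝ → ℝ, IsTestFunction δ f → ∫ x, f x ^ 2 ∂(expMeasure δ V) = 1 →
      sqEntropy (expMeasure δ V) f ≤ ((2 * weightedEnergy δ V f : ℝ≥0∞) : EReal)) ∧
    -- the Talagrand inequality
    (∀ f : ℝ → ℝ, AEMeasurable f (expMeasure δ V) → ∫ x, f x ^ 2 ∂(expMeasure δ V) = 1 →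
      ((wasserstein2 (transportDist δ V) (expMeasure δ V)
          (sqDensity (expMeasure δ V) f) ^ 2 : ℝ≥0∞) : EReal) ≤
        2 * sqEntropy (expMeasure δ V) f) ∧
    -- the HWI inequality
    (∀ f : ℝ → ℝ, IsTestFunction δ f → ∫ x, f x ^ 2 ∂(expMeasure δ V) = 1 →
      sqEntropy (expMeasure δ V) f +
          ((wasserstein2 (transportDist δ V) (expMeasure δ V)
            (sqDensity (expMeasure δ V) f) ^ 2 / 2 : ℝ≥0∞) : EReal) ≤
        ((2 * weightedEnergy δ V f ^ (1 / 2 : ℝ) *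
          wasserstein2 (transportDist δ V) (expMeasure δ V)
            (sqDensity (expMeasure δ V) f) : ℝ≥0∞) : EReal)) := by
  exact ⟨fun _ hf h1 => weighted_logSobolev_inequality hV hf h1,
    fun _ hf h1 => talagrand_inequality hV hf h1, fun _ hf h1 => hwi_inequality hV hf h1⟩
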